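/- Let $\rho$ be a $\sigma$-finite measure on $\mathbb{R}$ whose natural parameter space $\Theta=\{\theta\in\mathbb{R}:\int e^{\theta y}\,\rho(dy)<\infty\}$ is open and non-empty, and let $\psi(\theta)=\log\int e^{\theta y}\,\rho(dy)$. Each of $k$ arms has an unknown parameter $\theta\in\Theta$ and, given $\theta$, yields rewards with density $f(y\mid\theta)=e^{\theta y-\psi(\theta)}$ relative to $\rho$. The informational state of an arm is a pair $(\Sigma,n)$ with $n>0$ and $\int_\Theta e^{\Sigma\theta-n\psi(\theta)}\,d\theta<\infty$; it stands for the (independent) conjugate prior with Lebesgue density $g(\theta\mid\Sigma,n)\propto e^{\Sigma\theta-n\psi(\theta)}$ on $\Theta$. Given $(\Sigma,n)$ the next reward $Y$ has the predictive density $p(y\mid\Sigma,n)=\int_\Theta f(y\mid\theta)g(\theta\mid\Sigma,n)\,d\theta$ relative to $\rho$. Let $0\le\gamma\le1$. For an integer $t\ge1$ put $H(\gamma,t)=\gamma(1-\gamma^{t-1})/(1-\gamma)$ if $\gamma<1$, $H(1,t)=t-1$, and for $\lambda\in\mathbb{R}$ $$V_t^{KG}(\Sigma,n,\gamma,\lambda)=\max\left\{\frac{\Sigma}{n}-\lambda+H(\gamma,t)\,E\left[\max\left(\max\left(\frac{\Sigma+Y}{n+1},\lambda\right)-\lambda,\,0\right)\,\Big|\,\Sigma,n\right],\;0\right\},$$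 $$\nu_t^{KGI}(\Sigma,n,\gamma)=\min\{\lambda\in\mathbb{R}:V_t^{KG}(\Sigma,n,\gamma,\lambda)=0\},$$ and, when $\gamma<1$, $\nu_\infty^{KGI}(\Sigma,n,\gamma)=\lim_{t\to\infty}\nu_t^{KGI}(\Sigma,n,\gamma)$. An arm in state $(\Sigma,n)$ dominates one in state $(\Sigma',n')$ if $\Sigma/n>\Sigma'/n'$ and $n<n'$. For a horizon $T\in\{1,2,\dots\}\cup\{\infty\}$ (with $\gamma<1$ if $T=\infty$), the KGI policy chooses at each decision time $t$ with $0\le t<T$, in the current states $(\Sigma_a,n_a)_{1\le a\le k}$, an arm whose index $\nu_{T-t}^{KGI}(\Sigma_a,n_a,\gamma)$ is largest, ties being broken in any way. **Theorem.** (i) For every informational state $(\Sigma,n)$ these objects are well defined: $p(\cdot\mid\Sigma,n)$ is a probability density with finite mean $\Sigma/n$, the minimum that defines $\nu_t^{KGI}(\Sigma,n,\gamma)$ is attained for every integer $t\ge1$, and if $\gamma<1$ the limit $\nu_\infty^{KGI}(\Sigma,n,\gamma)$ exists and is finite. (ii) For every time-to-go $t\in\{1,2,\dots\}\cup\{\infty\}$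 (with $\gamma<1$ if $t=\infty$), $\nu_t^{KGI}(\Sigma,n,\gamma)$ is non-decreasing in $\Sigma$ for fixed $n$, and $\nu_t^{KGI}(c\Sigma,cn,\gamma)$ is non-increasing in $c>0$ for fixed $\Sigma,n$ (over all values for which the pairs concerned are informational states). (iii) The KGI policy does not choose dominated arms: for every horizon $T$, decision time $t$, number of arms $k$ and informational states of the arms, no arm that the KGI policy may choose is dominated by another arm. -/

import Mathlib

open MeasureTheory ProbabilityTheory Filter Topology
open scoped ENNReal

namespace KGBandit

/-- Natural parameter space `Θ = {θ | ∫ exp (θ y) dρ(y) < ∞}` of the exponential family generated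
by the reference measure `ρ` on `ℝ`. -/
def paramSpace (ρ : Measure ℝ) : Set ℝ := integrableExpSet id ρ

/-- Cumulant generating function `ψ(θ) = log ∫ exp (θ y) dρ(y)`. -/
noncomputable def psi (ρ : Measure ℝ) (θ : ℝ) : ℝ := cgf id ρ θ

/-- Reward density `f(y ∣ θ) = exp (θ y - ψ(θ))` relative to `ρ`. -/
noncomputable def rewardDensity (ρ : Measure ℝ) (θ y : ℝ) : ℝ :=
  Real.exp (θ * y - psi ρ θ)

/-- Unnormalised conjugate prior density `exp (Σ θ - n ψ(θ))`. -/
noncomputable def priorKernel (ρ : Measure ℝ) (S n θ : ℝ) : ℝ :=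
  Real.exp (S * θ - n * psi ρ θ)

/-- The informational state `(Σ, n)` is admissible: `n > 0` and the conjugate prior is proper. -/
def Admissible (ρ : Measure ℝ) (S n : ℝ) : Prop :=
  0 < n ∧ IntegrableOn (priorKernel ρ S n) (paramSpace ρ) volume

/-- Normalised conjugate prior density `g(θ ∣ Σ, n)` with respect to Lebesgue measure on `Θ`. -/
noncomputable def priorDensity (ρ : Measure ℝ) (S n θ : ℝ) : ℝ :=
  priorKernel ρ S n θ / ∫ η in paramSpace ρ, priorKernel ρ S n η

/-- Predictive density `p(y ∣ Σ, n) = ∫_Θ f(y ∣ θ) g(θ ∣ Σ, n) dθ` relative to `ρ`. -/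
noncomputable def predictiveDensity (ρ : Measure ℝ) (S n y : ℝ) : ℝ≥0∞ :=
  ∫⁻ θ in paramSpace ρ, ENNReal.ofReal (rewardDensity ρ θ y * priorDensity ρ S n θ)

/-- Predictive law of the next reward `Y` given the informational state `(Σ, n)`. -/
noncomputable def predictive (ρ : Measure ℝ) (S n : ℝ) : Measure ℝ :=
  ρ.withDensity (predictiveDensity ρ S n)

/-- The multiplier `H(γ, t)` for time-to-go `t ≥ 1`: it is `γ (1 - γ ^ (t - 1)) / (1 - γ)` when
`γ ≠ 1`, and `t - 1` when `γ = 1`. -/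
noncomputable def multiplier (γ : ℝ) (t : ℕ) : ℝ :=
  if γ = 1 then (t : ℝ) - 1 else γ * (1 - γ ^ (t - 1)) / (1 - γ)

/-- The one-step-lookahead stopping value `V_t^KG(Σ, n, γ, lam)`, with activation charge `lam`. -/
noncomputable def valueKG (ρ : Measure ℝ) (t : ℕ) (S n γ lam : ℝ) : ℝ :=
  max (S / n - lam + multiplier γ t *
      ∫ y, max (max ((S + y) / (n + 1)) lam - lam) 0 ∂(predictive ρ S n)) 0

/-- The index for finite time-to-go `t`: the smallest charge at which `V_t^KG` vanishes. -/
noncomputable def indexFin (ρ : Measure ℝ) (t : ℕ) (S n γ : ℝ) : ℝ :=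
  sInf {lam : ℝ | valueKG ρ t S n γ lam = 0}

/-- The KGI index for time-to-go `s`; for `s = ∞` it is the limit of the finite indices. -/
noncomputable def index (ρ : Measure ℝ) (s : ℕ∞) (S n γ : ℝ) : ℝ :=
  if s = ⊤ then limUnder atTop (fun t : ℕ => indexFin ρ t S n γ) else indexFin ρ s.toNat S n γ

/-- An arm in state `(S, n)` dominates one in state `(S', n')`. -/
def Dominates (S n S' n' : ℝ) : Prop := S' / n' < S / n ∧ n < n'

/-- At decision time `t` of a bandit with horizon `T`, in the informational state
`(S a, n a)`, `a : Fin k`, the KGI policy may choose arm `a`: its index for the time-to-go `T - t`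
is maximal among all arms (ties may be broken in any way). -/
def IsKGIAction (ρ : Measure ℝ) (γ : ℝ) (T : ℕ∞) (t : ℕ) {k : ℕ} (S n : Fin k → ℝ)
    (a : Fin k) : Prop :=
  ∀ b : Fin k, index ρ (T - t) (S b) (n b) γ ≤ index ρ (T - t) (S a) (n a) γ

end KGBandit

/-!
For a fixed weight `H ≥ 0` of learning, the value `Σ / n - lam + H * E[((Σ + Y) / (n + 1) - lam)⁺]`
of continuing is continuous and strictly decreasing in the charge `lam`, so the index with
multiplier `H` is its unique root, and the indices converge along with the multipliers as the
time-to-go tends to infinity (`tendsto_index`, `exists_continueValue_index_eq_zero`). Monotonicity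
of the index is thus monotonicity of the expected gain at each charge, for all times-to-go at once.

*Moments.* The prior kernel `exp (Σ θ - n ψ(θ))` is log-concave and integrable, and `ψ` blows up at
finite end points of the open parameter space, so the superlevel sets of the kernel are compact
intervals (`isCompact_superlevel`). Integrating the derivative of the kernel over these intervals
gives `E[ψ'(θ)] = Σ / n` (`integral_deriv_priorKernel`), and Fubini's theorem transfers this to the
predictive mean once a bound on absolute moments is known (`integrable_sub_mul_joint`).

*Comparison.* If `Σ` increases, the prior densities cross once; if the state is scaled up by
`c > 1`, their difference has the signs `-, +, -`, since the ratio of the densities is an increasing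
function of the log-concave kernel. The exponential family is totally positive, so the predictive
densities inherit these sign patterns (`predictive_single_crossing`,
`predictive_double_crossing`). Together with equality of the masses, and in the second case of the
means, this yields stochastic order (`integral_hinge_mono`) and convex order
(`integral_hinge_smul_le`) of the predictive laws.

A dominating arm is compared with the dominated one through the state that has the mean of the
first and the precision of the second. This state is admissible because scaling up preserves
propriety of the prior (`Admissible.smul`, `Dominates.index_lt`).
-/

namespace KGBandit

variable {ρ : Measure ℝ}

/-! ### The cumulant generating function -/

lemma mem_paramSpace {θ : ℝ} :
    θ ∈ paramSpace ρ ↔ Integrable (fun y => Real.exp (θ * y)) ρ := Iff.rfl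

lemma convex_paramSpace : Convex ℝ (paramSpace ρ) := convex_integrableExpSet

lemma measurable_psi [SFinite ρ] : Measurable (psi ρ) := by
  refine Real.measurable_log.comp ?_
  have h : StronglyMeasurable (Function.uncurry fun θ y : ℝ => Real.exp (θ * id y)) :=
    Measurable.stronglyMeasurable (by simp only [id]; fun_prop)
  exact h.integral_prod_right.measurable

lemma exp_psi [NeZero ρ] {θ : ℝ} (hθ : θ ∈ paramSpace ρ) :
    Real.exp (psi ρ θ) = ∫ y, Real.exp (θ * y) ∂ρ := exp_cgf hθ

lemma integrable_rewardDensity {θ : ℝ} (hθ : θ ∈ paramSpace ρ) :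
    Integrable (rewardDensity ρ θ) ρ := by
  have h := (mem_paramSpace.1 hθ).div_const (Real.exp (psi ρ θ))
  simp only [← Real.exp_sub] at h
  exact h

lemma integral_rewardDensity [NeZero ρ] {θ : ℝ} (hθ : θ ∈ paramSpace ρ) :
    ∫ y, rewardDensity ρ θ y ∂ρ = 1 := by
  simp only [rewardDensity, Real.exp_sub]
  rw [integral_div, ← exp_psi hθ, div_self (Real.exp_ne_zero _)]

lemma convexOn_psi [NeZero ρ] : ConvexOn ℝ (paramSpace ρ) (psi ρ) := by
  refine ⟨convex_paramSpace, fun x hx y hy a b ha hb hab => ?_⟩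
  have hz := convex_paramSpace hx hy ha hb hab
  simp only [smul_eq_mul] at hz ⊢
  -- convexity of `exp` at the exponents of the two reward densities, integrated over `ρ`
  have key : Real.exp (psi ρ (a * x + b * y) - (a * psi ρ x + b * psi ρ y)) ≤ 1 := by
    have h1 : ∫ w, Real.exp ((a * x + b * y) * w) / Real.exp (a * psi ρ x + b * psi ρ y) ∂ρ
        ≤ ∫ w, (a * rewardDensity ρ x w + b * rewardDensity ρ y w) ∂ρ := by
      refine integral_mono (Integrable.div_const hz _)
        (((integrable_rewardDensity hx).const_mul a).add
          ((integrable_rewardDensity hy).const_mul b)) fun w => ?_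
      have := convexOn_exp.2 (Set.mem_univ (x * w - psi ρ x)) (Set.mem_univ (y * w - psi ρ y))
        ha hb hab
      simp only [smul_eq_mul] at this
      simp only [rewardDensity, ← Real.exp_sub]
      refine le_trans (le_of_eq ?_) this
      congr 1
      ring
    rw [integral_div, ← exp_psi hz, integral_add ((integrable_rewardDensity hx).const_mul a)
      ((integrable_rewardDensity hy).const_mul b), integral_const_mul, integral_const_mul,
      integral_rewardDensity hx, integral_rewardDensity hy, ← Real.exp_sub] at h1
    linarith
  have := Real.exp_le_one_iff.1 key
  linarith

lemma differentiableAt_psi (hΘ : IsOpen (paramSpace ρ)) {θ : ℝ} (hθ : θ ∈ paramSpace ρ) :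
    DifferentiableAt ℝ (psi ρ) θ :=
  (analyticAt_cgf (by rwa [← paramSpace, hΘ.interior_eq])).differentiableAt

lemma continuousOn_deriv_psi (hΘ : IsOpen (paramSpace ρ)) :
    ContinuousOn (deriv (psi ρ)) (paramSpace ρ) := fun _ hθ =>
  (analyticAt_cgf (by rwa [← paramSpace, hΘ.interior_eq])).deriv.continuousAt.continuousWithinAt

lemma integrable_mul_rewardDensity (hΘ : IsOpen (paramSpace ρ)) {θ : ℝ}
    (hθ : θ ∈ paramSpace ρ) : Integrable (fun y => y * rewardDensity ρ θ y) ρ := by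
  have h := integrable_pow_mul_exp_of_mem_interior_integrableExpSet (X := id) (μ := ρ) (v := θ)
    (by rwa [← paramSpace, hΘ.interior_eq]) 1
  simpa only [rewardDensity, Real.exp_sub, pow_one, id, mul_div_assoc] using
    h.div_const (Real.exp (psi ρ θ))

lemma integral_mul_rewardDensity [NeZero ρ] (hΘ : IsOpen (paramSpace ρ)) {θ : ℝ}
    (hθ : θ ∈ paramSpace ρ) : ∫ y, y * rewardDensity ρ θ y ∂ρ = deriv (psi ρ) θ := by
  have h := deriv_cgf (X := id) (μ := ρ) (v := θ) (by rwa [← paramSpace, hΘ.interior_eq])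
  change _ = deriv (cgf id ρ) θ
  rw [h, ← exp_cgf hθ]
  simp only [rewardDensity, Real.exp_sub, ← mul_div_assoc]
  rw [integral_div]
  rfl

/-- The cumulant generating function blows up at the finite end points of the open parameter
space: by Fatou's lemma, a limit of parameters along which `ψ` stays bounded is a parameter. -/
lemma mem_paramSpace_of_tendsto [NeZero ρ] {l : Filter ℝ} [l.NeBot] [l.IsCountablyGenerated]
    {b C : ℝ} (hl : l ≤ 𝓝 b) (hmem : ∀ᶠ θ in l, θ ∈ paramSpace ρ)
    (hC : ∀ᶠ θ in l, psi ρ θ ≤ C) : b ∈ paramSpace ρ := by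
  have hfin : ∫⁻ y, ENNReal.ofReal (Real.exp (b * y)) ∂ρ ≤ ENNReal.ofReal (Real.exp C) := by
    calc ∫⁻ y, ENNReal.ofReal (Real.exp (b * y)) ∂ρ
        = ∫⁻ y, liminf (fun θ => ENNReal.ofReal (Real.exp (θ * y))) l ∂ρ := by
          refine lintegral_congr fun y => (Tendsto.liminf_eq ?_).symm
          have : Continuous fun θ : ℝ => ENNReal.ofReal (Real.exp (θ * y)) :=
            ENNReal.continuous_ofReal.comp (by fun_prop)
          exact (this.tendsto b).mono_left hl
      _ ≤ liminf (fun θ => ∫⁻ y, ENNReal.ofReal (Real.exp (θ * y)) ∂ρ) l :=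
          lintegral_liminf_le fun θ => by fun_prop
      _ ≤ ENNReal.ofReal (Real.exp C) := by
          refine liminf_le_of_frequently_le' (Eventually.frequently ?_)
          filter_upwards [hmem, hC] with θ hθ hθC
          rw [← ofReal_integral_eq_lintegral_ofReal (mem_paramSpace.1 hθ)
              (ae_of_all _ fun _ => (Real.exp_pos _).le),
            ← exp_psi hθ]
          exact ENNReal.ofReal_le_ofReal (Real.exp_le_exp.2 hθC)
  refine mem_paramSpace.2 ⟨by fun_prop, ?_⟩
  rw [hasFiniteIntegral_iff_ofReal (ae_of_all _ fun _ => (Real.exp_pos _).le)]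
  exact hfin.trans_lt ENNReal.ofReal_lt_top

/-! ### Superlevel sets of the conjugate prior -/

/-- An interval of finite length is bounded. -/
lemma isBounded_of_ordConnected {s : Set ℝ} (hs : s.OrdConnected) (hvol : volume s < ∞) :
    Bornology.IsBounded s := by
  rcases s.eq_empty_or_nonempty with rfl | ⟨x, hx⟩
  · exact Bornology.isBounded_empty
  rw [isBounded_iff_bddBelow_bddAbove]
  constructor <;> by_contra h
  · have : Set.Iic x ⊆ s := fun y hy => by
      obtain ⟨z, hz, hzy⟩ := not_bddBelow_iff.1 h y
      exact hs.out hz hx ⟨hzy.le, hy⟩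
    exact absurd ((measure_mono this).trans_lt hvol) (by simp)
  · have : Set.Ici x ⊆ s := fun y hy => by
      obtain ⟨z, hz, hzy⟩ := not_bddAbove_iff.1 h y
      exact hs.out hx hz ⟨hy, hzy.le⟩
    exact absurd ((measure_mono this).trans_lt hvol) (by simp)

lemma measurable_priorKernel [SFinite ρ] (S n : ℝ) : Measurable (priorKernel ρ S n) := by
  have := measurable_psi (ρ := ρ)
  unfold priorKernel
  fun_prop

lemma priorKernel_pos (S n θ : ℝ) : 0 < priorKernel ρ S n θ := Real.exp_pos _

lemma measurableSet_paramSpace [SFinite ρ] : MeasurableSet (paramSpace ρ) :=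
  convex_paramSpace.ordConnected.measurableSet

/-- Without a reference measure no conjugate prior is proper: the kernel is `exp (Σ θ)` on the
whole line. -/
lemma Admissible.neZero {S n : ℝ} (h : Admissible ρ S n) : NeZero ρ := by
  refine ⟨fun h0 => ?_⟩
  subst h0
  have hΘ : paramSpace (0 : Measure ℝ) = Set.univ := by
    ext θ; simp [mem_paramSpace]
  have hi := h.2
  rw [hΘ, integrableOn_univ] at hi
  have h1 : Integrable (fun θ : ℝ => Real.exp (S * θ)) := by
    refine hi.congr (ae_of_all _ fun θ => ?_)
    simp [priorKernel, psi]
  have h2 : Integrable (fun θ : ℝ => Real.exp (S * -θ)) := h1.comp_neg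
  have h3 : Integrable (fun _ : ℝ => (1 : ℝ)) := by
    refine (h1.add h2).mono' (by fun_prop) (ae_of_all _ fun θ => ?_)
    rw [norm_one, Pi.add_apply]
    have e1 := Real.add_one_le_exp (S * θ)
    have e2 := Real.add_one_le_exp (S * -θ)
    linarith
  rw [integrable_const_iff] at h3
  simp [isFiniteMeasure_iff] at h3

/-- The part of the parameter space on which the conjugate prior kernel is at least `ε`. -/
def superlevel (ρ : Measure ℝ) (S n ε : ℝ) : Set ℝ :=
  {θ ∈ paramSpace ρ | ε ≤ priorKernel ρ S n θ}

lemma concaveOn_exponent [NeZero ρ] {S n : ℝ} (hn : 0 ≤ n) :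
    ConcaveOn ℝ (paramSpace ρ) fun θ => S * θ - n * psi ρ θ := by
  have h1 : ConcaveOn ℝ (paramSpace ρ) fun θ : ℝ => S * θ :=
    (LinearMap.mulLeft ℝ S).concaveOn convex_paramSpace
  exact h1.sub (convexOn_psi.smul hn)

lemma ordConnected_superlevel [NeZero ρ] {S n ε : ℝ} (hn : 0 ≤ n) (hε : 0 < ε) :
    (superlevel ρ S n ε).OrdConnected := by
  have h := (concaveOn_exponent (ρ := ρ) (S := S) hn).convex_ge (Real.log ε)
  have : superlevel ρ S n ε
      = {θ ∈ paramSpace ρ | Real.log ε ≤ S * θ - n * psi ρ θ} := by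
    ext θ
    simp only [superlevel, priorKernel, Set.mem_ofPred_eq, Real.log_le_iff_le_exp hε]
  rw [this]
  exact h.ordConnected

lemma continuousOn_priorKernel (hΘ : IsOpen (paramSpace ρ)) (S n : ℝ) :
    ContinuousOn (priorKernel ρ S n) (paramSpace ρ) := by
  have : ContinuousOn (psi ρ) (paramSpace ρ) := fun θ hθ =>
    (differentiableAt_psi hΘ hθ).continuousAt.continuousWithinAt
  unfold priorKernel
  fun_prop

/-- The kernel of a proper conjugate prior tends to zero at both ends of the parameter space:
its superlevel sets are intervals, bounded since the prior is proper, and closed since `ψ` blows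
up at finite end points. -/
lemma isCompact_superlevel [SFinite ρ] (hΘ : IsOpen (paramSpace ρ)) {S n ε : ℝ}
    (h : Admissible ρ S n) (hε : 0 < ε) : IsCompact (superlevel ρ S n ε) := by
  have := h.neZero
  refine Metric.isCompact_of_isClosed_isBounded (isClosed_of_closure_subset fun b hb => ?_)
    (isBounded_of_ordConnected (ordConnected_superlevel h.1.le hε) ?_)
  · have hne : (𝓝[superlevel ρ S n ε] b).NeBot := mem_closure_iff_nhdsWithin_neBot.1 hb
    have hmem : ∀ᶠ θ in 𝓝[superlevel ρ S n ε] b, θ ∈ superlevel ρ S n ε := self_mem_nhdsWithin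
    have hbΘ : b ∈ paramSpace ρ := by
      have hlin : ∀ᶠ θ in 𝓝[superlevel ρ S n ε] b, S * θ < S * b + 1 := by
        have hc : Continuous fun θ : ℝ => S * θ := by fun_prop
        exact nhdsWithin_le_nhds (hc.continuousAt.eventually_lt_const (by simp))
      refine mem_paramSpace_of_tendsto (C := (S * b + 1 - Real.log ε) / n) nhdsWithin_le_nhds
        (hmem.mono fun θ hθ => hθ.1) ?_
      filter_upwards [hmem, hlin] with θ hθ hlt
      have h2 := (Real.log_le_iff_le_exp hε).2 hθ.2
      rw [le_div_iff₀ h.1]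
      linarith
    refine ⟨hbΘ, ge_of_tendsto ?_ (hmem.mono fun θ hθ => hθ.2)⟩
    exact ((continuousOn_priorKernel hΘ S n b hbΘ).mono fun θ hθ => hθ.1).tendsto
  · have hm := (Integrable.measure_ge_lt_top h.2 hε)
    rw [Measure.restrict_apply
      (measurableSet_le measurable_const (measurable_priorKernel S n))] at hm
    refine (measure_mono ?_).trans_lt hm
    exact fun θ hθ => ⟨hθ.2, hθ.1⟩

/-- A proper conjugate prior has a mode. -/
lemma exists_mode [SFinite ρ] (hΘ : IsOpen (paramSpace ρ)) (hne : (paramSpace ρ).Nonempty)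
    {S n : ℝ} (h : Admissible ρ S n) :
    ∃ θ₀ ∈ paramSpace ρ, ∀ θ ∈ paramSpace ρ, priorKernel ρ S n θ ≤ priorKernel ρ S n θ₀ := by
  obtain ⟨η, hη⟩ := hne
  obtain ⟨θ₀, h0, hmax⟩ := (isCompact_superlevel hΘ h (priorKernel_pos S n η)).exists_isMaxOn
    ⟨η, hη, le_rfl⟩ ((continuousOn_priorKernel hΘ S n).mono fun θ hθ => hθ.1)
  refine ⟨θ₀, h0.1, fun θ hθ => ?_⟩
  by_cases hc : priorKernel ρ S n η ≤ priorKernel ρ S n θ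
  · exact hmax ⟨hθ, hc⟩
  · exact (not_le.1 hc).le.trans h0.2

/-- Scaling up a state keeps the prior proper. -/
lemma Admissible.smul [SFinite ρ] (hΘ : IsOpen (paramSpace ρ)) (hne : (paramSpace ρ).Nonempty)
    {S n c : ℝ} (h : Admissible ρ S n) (hc : 1 ≤ c) : Admissible ρ (c * S) (c * n) := by
  obtain ⟨θ₀, -, hmax⟩ := exists_mode hΘ hne h
  have hc0 : 0 < c := by linarith
  refine ⟨mul_pos hc0 h.1, ?_⟩
  have hpow : ∀ θ, priorKernel ρ (c * S) (c * n) θ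
      = priorKernel ρ S n θ ^ (c - 1) * priorKernel ρ S n θ := fun θ => by
    simp only [priorKernel, ← Real.exp_mul, ← Real.exp_add]
    congr 1
    ring
  refine Integrable.mono' (Integrable.const_mul h.2 (priorKernel ρ S n θ₀ ^ (c - 1)))
    (measurable_priorKernel _ _).aestronglyMeasurable ?_
  filter_upwards [ae_restrict_mem measurableSet_paramSpace] with θ hθ
  rw [Real.norm_of_nonneg (priorKernel_pos _ _ _).le, hpow]
  gcongr
  · exact (priorKernel_pos _ _ _).le
  · exact (priorKernel_pos _ _ _).le
  · exact hmax θ hθ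

/-! ### The prior mean of the reward mean -/

lemma superlevel_eq_Icc [SFinite ρ] (hΘ : IsOpen (paramSpace ρ)) {S n ε θ₀ : ℝ}
    (h : Admissible ρ S n) (hε : 0 < ε) (hθ₀ : θ₀ ∈ superlevel ρ S n ε) :
    ∃ a b, superlevel ρ S n ε = Set.Icc a b ∧ a ≤ θ₀ ∧ θ₀ ≤ b ∧
      priorKernel ρ S n a = ε ∧ priorKernel ρ S n b = ε := by
  have := h.neZero
  have hI := eq_Icc_of_connected_compact
    ⟨⟨θ₀, hθ₀⟩, (ordConnected_superlevel h.1.le hε).isPreconnected⟩ (isCompact_superlevel hΘ h hε)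
  set a := sInf (superlevel ρ S n ε)
  set b := sSup (superlevel ρ S n ε)
  have h0 : θ₀ ∈ Set.Icc a b := hI ▸ hθ₀
  have hab : a ≤ b := h0.1.trans h0.2
  -- where the kernel exceeds `ε`, it does so on a neighbourhood
  have key : ∀ θ ∈ superlevel ρ S n ε, ε < priorKernel ρ S n θ →
      ∀ᶠ η in 𝓝 θ, η ∈ Set.Icc a b := fun θ hθ hlt => by
    have hc := (continuousOn_priorKernel hΘ S n).continuousAt (hΘ.mem_nhds hθ.1)
    filter_upwards [hΘ.mem_nhds hθ.1, hc.eventually_const_lt hlt] with η h1 h2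
    rw [← hI]
    exact ⟨h1, h2.le⟩
  have ha : a ∈ superlevel ρ S n ε := by rw [hI]; exact ⟨le_rfl, hab⟩
  have hb : b ∈ superlevel ρ S n ε := by rw [hI]; exact ⟨hab, le_rfl⟩
  refine ⟨a, b, hI, h0.1, h0.2, ?_, ?_⟩
  · refine le_antisymm (not_lt.1 fun hlt => ?_) ha.2
    obtain ⟨η, hη, hηa⟩ := (((key a ha hlt).filter_mono nhdsWithin_le_nhds).and
      (self_mem_nhdsWithin (s := Set.Iio a))).exists
    exact absurd hη.1 (not_le.2 hηa)
  · refine le_antisymm (not_lt.1 fun hlt => ?_) hb.2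
    obtain ⟨η, hη, hηb⟩ := (((key b hb hlt).filter_mono nhdsWithin_le_nhds).and
      (self_mem_nhdsWithin (s := Set.Ioi b))).exists
    exact absurd hη.2 (not_le.2 hηb)

lemma hasDerivAt_exponent (hΘ : IsOpen (paramSpace ρ)) (S n : ℝ) {θ : ℝ}
    (hθ : θ ∈ paramSpace ρ) :
    HasDerivAt (fun η => S * η - n * psi ρ η) (S - n * deriv (psi ρ) θ) θ := by
  simpa using ((hasDerivAt_id θ).const_mul S).fun_sub
    ((differentiableAt_psi hΘ hθ).hasDerivAt.const_mul n)

lemma hasDerivAt_priorKernel (hΘ : IsOpen (paramSpace ρ)) (S n : ℝ) {θ : ℝ}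
    (hθ : θ ∈ paramSpace ρ) :
    HasDerivAt (priorKernel ρ S n) (priorKernel ρ S n θ * (S - n * deriv (psi ρ) θ)) θ :=
  (hasDerivAt_exponent hΘ S n hθ).exp

/-- The derivative of the prior kernel has integral zero over the parameter space. On the
superlevel set `[a, b]` at height `ε` its integral is exactly `ε - ε`, and the integral of its
absolute value is at most twice the maximum of the kernel, as the kernel is unimodal. -/
lemma integral_deriv_priorKernel [SFinite ρ] (hΘ : IsOpen (paramSpace ρ))
    (hne : (paramSpace ρ).Nonempty) {S n : ℝ} (h : Admissible ρ S n) :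
    IntegrableOn (fun θ => priorKernel ρ S n θ * (S - n * deriv (psi ρ) θ)) (paramSpace ρ) ∧
    ∫ θ in paramSpace ρ, priorKernel ρ S n θ * (S - n * deriv (psi ρ) θ) = 0 := by
  have := h.neZero
  obtain ⟨θ₀, hθ₀, hmax⟩ := exists_mode hΘ hne h
  set K := priorKernel ρ S n with hK
  set g : ℝ → ℝ := fun θ => K θ * (S - n * deriv (psi ρ) θ) with hg
  have hgc : ContinuousOn g (paramSpace ρ) := by
    have h1 := continuousOn_priorKernel hΘ S n
    have h2 := continuousOn_deriv_psi hΘ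
    exact h1.mul (continuousOn_const.sub (continuousOn_const.mul h2))
  have hpos : ∀ j : ℕ, (0 : ℝ) < 1 / (j + 1) := fun j => by positivity
  have hlim := tendsto_one_div_add_atTop_nhds_zero_nat (𝕜 := ℝ)
  set φ : ℕ → Set ℝ := fun j => superlevel ρ S n (1 / (j + 1)) with hφ
  have hsub : ∀ j, φ j ⊆ paramSpace ρ := fun j θ hθ => hθ.1
  have hcover : AECover (volume.restrict (paramSpace ρ)) atTop φ := by
    refine ⟨?_, fun j => (ordConnected_superlevel h.1.le (hpos j)).measurableSet⟩
    filter_upwards [ae_restrict_mem measurableSet_paramSpace] with θ hθ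
    filter_upwards [hlim.eventually_le_const (priorKernel_pos S n θ)] with j hj
    exact ⟨hθ, hj⟩
  have hrestrict : ∀ j, (volume.restrict (paramSpace ρ)).restrict (φ j) = volume.restrict (φ j) :=
    fun j => Measure.restrict_restrict_of_subset (hsub j)
  have hfi : ∀ j, IntegrableOn g (φ j) (volume.restrict (paramSpace ρ)) := fun j => by
    rw [IntegrableOn, hrestrict]
    exact (hgc.mono (hsub j)).integrableOn_compact (isCompact_superlevel hΘ h (hpos j))
  have hev : ∀ᶠ j : ℕ in atTop, θ₀ ∈ φ j := by
    filter_upwards [hlim.eventually_le_const (priorKernel_pos S n θ₀)] with j hj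
    exact ⟨hθ₀, hj⟩
  have hconc := concaveOn_exponent (ρ := ρ) (S := S) h.1.le
  have hmax' : ∀ θ ∈ paramSpace ρ, S * θ - n * psi ρ θ ≤ S * θ₀ - n * psi ρ θ₀ :=
    fun θ hθ => Real.exp_le_exp.1 (hmax θ hθ)
  have hleft : ∀ θ ∈ paramSpace ρ, θ ≤ θ₀ → 0 ≤ g θ := fun θ hθ hle => by
    refine mul_nonneg (priorKernel_pos S n θ).le ?_
    rcases hle.eq_or_lt with rfl | hlt
    · have hm : IsLocalMax (fun η => S * η - n * psi ρ η) θ :=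
        eventually_of_mem (hΘ.mem_nhds hθ) hmax'
      exact (hm.hasDerivAt_eq_zero (hasDerivAt_exponent hΘ S n hθ)).ge
    · refine le_trans ?_ (hconc.slope_le_of_hasDerivAt hθ hθ₀ hlt (hasDerivAt_exponent hΘ S n hθ))
      rw [slope_def_field]
      exact div_nonneg (sub_nonneg.2 (hmax' θ hθ)) (sub_nonneg.2 hle)
  have hright : ∀ θ ∈ paramSpace ρ, θ₀ ≤ θ → g θ ≤ 0 := fun θ hθ hle => by
    refine mul_nonpos_of_nonneg_of_nonpos (priorKernel_pos S n θ).le ?_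
    rcases hle.eq_or_lt with rfl | hlt
    · have hm : IsLocalMax (fun η => S * η - n * psi ρ η) θ₀ :=
        eventually_of_mem (hΘ.mem_nhds hθ) hmax'
      exact (hm.hasDerivAt_eq_zero (hasDerivAt_exponent hΘ S n hθ)).le
    · refine (hconc.le_slope_of_hasDerivAt hθ₀ hθ hlt (hasDerivAt_exponent hΘ S n hθ)).trans ?_
      rw [slope_def_field]
      exact div_nonpos_of_nonpos_of_nonneg (sub_nonpos.2 (hmax' θ hθ)) (sub_nonneg.2 hle)
  -- the fundamental theorem of calculus inside the parameter space
  have hftc : ∀ a b, a ≤ b → Set.Icc a b ⊆ paramSpace ρ →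
      IntervalIntegrable g volume a b ∧ ∫ θ in a..b, g θ = K b - K a := fun a b hab hs => by
    have hi : IntervalIntegrable g volume a b :=
      ContinuousOn.intervalIntegrable (by rw [Set.uIcc_of_le hab]; exact hgc.mono hs)
    refine ⟨hi, intervalIntegral.integral_eq_sub_of_hasDerivAt (fun θ hθ => ?_) hi⟩
    rw [Set.uIcc_of_le hab] at hθ
    exact hasDerivAt_priorKernel hΘ S n (hs hθ)
  have hbound : ∀ᶠ j in atTop,
      ∫ θ in φ j, ‖g θ‖ ∂(volume.restrict (paramSpace ρ)) ≤ 2 * K θ₀ := by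
    filter_upwards [hev] with j hj
    obtain ⟨a, b, hab, ha0, h0b, hKa, hKb⟩ := superlevel_eq_Icc hΘ h (hpos j) hj
    have hs : Set.Icc a b ⊆ paramSpace ρ := hab ▸ hsub j
    have hs1 : Set.Icc a θ₀ ⊆ paramSpace ρ := (Set.Icc_subset_Icc_right h0b).trans hs
    have hs2 : Set.Icc θ₀ b ⊆ paramSpace ρ := (Set.Icc_subset_Icc_left ha0).trans hs
    obtain ⟨i1, e1⟩ := hftc a θ₀ ha0 hs1
    obtain ⟨i2, e2⟩ := hftc θ₀ b h0b hs2
    rw [hrestrict, hφ]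
    simp only
    rw [hab, integral_Icc_eq_integral_Ioc, ← intervalIntegral.integral_of_le (ha0.trans h0b),
      ← intervalIntegral.integral_add_adjacent_intervals i1.norm i2.norm]
    have e3 : ∫ θ in a..θ₀, ‖g θ‖ = ∫ θ in a..θ₀, g θ :=
      intervalIntegral.integral_congr fun θ hθ => by
        rw [Set.uIcc_of_le ha0] at hθ
        exact Real.norm_of_nonneg (hleft θ (hs1 hθ) hθ.2)
    have e4 : ∫ θ in θ₀..b, ‖g θ‖ = ∫ θ in θ₀..b, -g θ :=
      intervalIntegral.integral_congr fun θ hθ => by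
        rw [Set.uIcc_of_le h0b] at hθ
        exact Real.norm_of_nonpos (hright θ (hs2 hθ) hθ.1)
    rw [e3, e4, intervalIntegral.integral_neg, e1, e2]
    have := priorKernel_pos (ρ := ρ) S n a
    have := priorKernel_pos (ρ := ρ) S n b
    linarith
  have hint := hcover.integrable_of_integral_norm_bounded _ hfi hbound
  refine ⟨hint, hcover.integral_eq_of_tendsto 0 hint (tendsto_const_nhds.congr' ?_)⟩
  filter_upwards [hev] with j hj
  obtain ⟨a, b, hab, ha0, h0b, hKa, hKb⟩ := superlevel_eq_Icc hΘ h (hpos j) hj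
  have hs : Set.Icc a b ⊆ paramSpace ρ := hab ▸ hsub j
  rw [hrestrict, hφ]
  simp only
  rw [hab, integral_Icc_eq_integral_Ioc, ← intervalIntegral.integral_of_le (ha0.trans h0b),
    (hftc a b (ha0.trans h0b) hs).2, hK, hKa, hKb, sub_self]

lemma integral_priorKernel_pos [SFinite ρ] (hΘ : IsOpen (paramSpace ρ))
    (hne : (paramSpace ρ).Nonempty) {S n : ℝ} (h : Admissible ρ S n) :
    0 < ∫ θ in paramSpace ρ, priorKernel ρ S n θ := by
  rw [integral_pos_iff_support_of_nonneg (fun θ => (priorKernel_pos S n θ).le) h.2]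
  have : Function.support (priorKernel ρ S n) = Set.univ := by
    ext θ; simp [(priorKernel_pos S n θ).ne']
  rw [this, Measure.restrict_apply_univ]
  exact hΘ.measure_pos volume hne

lemma priorDensity_pos [SFinite ρ] (hΘ : IsOpen (paramSpace ρ))
    (hne : (paramSpace ρ).Nonempty) {S n : ℝ} (h : Admissible ρ S n) (θ : ℝ) :
    0 < priorDensity ρ S n θ :=
  div_pos (priorKernel_pos S n θ) (integral_priorKernel_pos hΘ hne h)

lemma integrableOn_priorDensity {S n : ℝ} (h : Admissible ρ S n) :
    IntegrableOn (priorDensity ρ S n) (paramSpace ρ) := h.2.div_const _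

lemma integral_priorDensity [SFinite ρ] (hΘ : IsOpen (paramSpace ρ))
    (hne : (paramSpace ρ).Nonempty) {S n : ℝ} (h : Admissible ρ S n) :
    ∫ θ in paramSpace ρ, priorDensity ρ S n θ = 1 := by
  simp only [priorDensity]
  rw [integral_div, div_self (integral_priorKernel_pos hΘ hne h).ne']

lemma measurable_priorDensity [SFinite ρ] (S n : ℝ) : Measurable (priorDensity ρ S n) :=
  (measurable_priorKernel S n).div_const _

/-- Under a proper conjugate prior, the reward mean `ψ'(θ)` has expectation `Σ / n`. -/
lemma integral_deriv_psi_mul_priorDensity [SFinite ρ] (hΘ : IsOpen (paramSpace ρ))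
    (hne : (paramSpace ρ).Nonempty) {S n : ℝ} (h : Admissible ρ S n) :
    IntegrableOn (fun θ => (deriv (psi ρ) θ - S / n) * priorDensity ρ S n θ) (paramSpace ρ) ∧
    ∫ θ in paramSpace ρ, (deriv (psi ρ) θ - S / n) * priorDensity ρ S n θ = 0 := by
  obtain ⟨h1, h2⟩ := integral_deriv_priorKernel hΘ hne h
  have hn := h.1.ne'
  set Z := ∫ θ in paramSpace ρ, priorKernel ρ S n θ with hZ
  have e : (fun θ => (deriv (psi ρ) θ - S / n) * priorDensity ρ S n θ)
      = fun θ => (-1 / (n * Z)) * (priorKernel ρ S n θ * (S - n * deriv (psi ρ) θ)) := by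
    funext θ
    have hZ0 : Z ≠ 0 := (integral_priorKernel_pos hΘ hne h).ne'
    simp only [priorDensity, ← hZ]
    field_simp
    ring
  rw [e]
  exact ⟨h1.const_mul _, by rw [integral_const_mul, h2, mul_zero]⟩

/-! ### The predictive law -/

lemma measurable_joint [SFinite ρ] (S n : ℝ) :
    Measurable fun z : ℝ × ℝ => rewardDensity ρ z.1 z.2 * priorDensity ρ S n z.1 := by
  have h1 := measurable_psi (ρ := ρ)
  have h2 := measurable_priorDensity (ρ := ρ) S n
  unfold rewardDensity
  fun_prop

lemma integrable_joint [SFinite ρ] (hΘ : IsOpen (paramSpace ρ)) (hne : (paramSpace ρ).Nonempty)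
    {S n : ℝ} (h : Admissible ρ S n) :
    Integrable (fun z : ℝ × ℝ => rewardDensity ρ z.1 z.2 * priorDensity ρ S n z.1)
      ((volume.restrict (paramSpace ρ)).prod ρ) := by
  have := h.neZero
  refine (integrable_prod_iff (measurable_joint S n).aestronglyMeasurable).2 ⟨?_, ?_⟩
  · filter_upwards [ae_restrict_mem measurableSet_paramSpace] with θ hθ
    exact (integrable_rewardDensity hθ).mul_const _
  · refine (integrableOn_priorDensity h).congr ?_
    filter_upwards [ae_restrict_mem measurableSet_paramSpace] with θ hθ
    have e : ∀ y, ‖rewardDensity ρ θ y * priorDensity ρ S n θ‖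
        = rewardDensity ρ θ y * priorDensity ρ S n θ := fun y =>
      Real.norm_of_nonneg (mul_nonneg (Real.exp_pos _).le (priorDensity_pos hΘ hne h θ).le)
    simp only [e]
    rw [integral_mul_const, integral_rewardDensity hθ, one_mul]

/-- A bound on the first absolute moment of the reward, centred at any `m`. Divided by
`exp (m θ - ψ(θ))`, the expectation of the negative part of `Y - m` decreases in `θ` and that of
the positive part increases. Hence one of the two parts is controlled by its value at `θ₀`, and the
other one by the mean. -/
lemma integral_abs_sub_mul_rewardDensity_le [NeZero ρ] (hΘ : IsOpen (paramSpace ρ)) (m : ℝ)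
    {θ θ₀ : ℝ} (hθ : θ ∈ paramSpace ρ) (hθ₀ : θ₀ ∈ paramSpace ρ) :
    ∫ y, |y - m| * rewardDensity ρ θ y ∂ρ ≤ |deriv (psi ρ) θ - m|
      + 2 * (∫ y, |y - m| * Real.exp (θ₀ * (y - m)) ∂ρ) * Real.exp (m * θ - psi ρ θ) := by
  have hint : ∀ η ∈ paramSpace ρ, Integrable (fun y => (y - m) * rewardDensity ρ η y) ρ :=
    fun η hη => by
      simp only [sub_mul]
      exact (integrable_mul_rewardDensity hΘ hη).sub ((integrable_rewardDensity hη).const_mul m)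
  have habs : ∀ η ∈ paramSpace ρ, Integrable (fun y => |y - m| * rewardDensity ρ η y) ρ :=
    fun η hη => (hint η hη).norm.congr (ae_of_all _ fun y => by
      simp [rewardDensity])
  have hval : ∫ y, (y - m) * rewardDensity ρ θ y ∂ρ = deriv (psi ρ) θ - m := by
    simp only [sub_mul]
    rw [integral_sub (integrable_mul_rewardDensity hΘ hθ)
      ((integrable_rewardDensity hθ).const_mul m), integral_const_mul, integral_rewardDensity hθ,
      integral_mul_rewardDensity hΘ hθ, mul_one]
  have hC : Integrable (fun y => |y - m| * Real.exp (θ₀ * (y - m))) ρ := by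
    refine ((habs θ₀ hθ₀).mul_const (Real.exp (psi ρ θ₀ - m * θ₀))).congr (ae_of_all _ fun y => ?_)
    simp only [rewardDensity]
    rw [mul_assoc, ← Real.exp_add]
    congr 2
    ring
  have hf : ∀ y, rewardDensity ρ θ y
      = Real.exp (θ * (y - m)) * Real.exp (m * θ - psi ρ θ) := fun y => by
    rw [rewardDensity, ← Real.exp_add]
    congr 1
    ring
  -- the sign `σ` of `θ - θ₀` decides which part is controlled by `θ₀`
  have key : ∀ σ : ℝ, (∀ y, |y - m| * Real.exp (θ * (y - m))
        ≤ σ * ((y - m) * Real.exp (θ * (y - m))) + 2 * (|y - m| * Real.exp (θ₀ * (y - m)))) →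
      ∫ y, |y - m| * rewardDensity ρ θ y ∂ρ ≤ σ * (deriv (psi ρ) θ - m)
      + 2 * (∫ y, |y - m| * Real.exp (θ₀ * (y - m)) ∂ρ) * Real.exp (m * θ - psi ρ θ) := by
    intro σ hσ
    have h1 := integral_mono (habs θ hθ) (((hint θ hθ).const_mul σ).add
      ((hC.const_mul 2).mul_const (Real.exp (m * θ - psi ρ θ)))) fun y => by
        have := mul_le_mul_of_nonneg_right (hσ y) (Real.exp_pos (m * θ - psi ρ θ)).le
        simp only [Pi.add_apply, hf]
        linarith
    refine h1.trans (le_of_eq ?_)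
    simp only [Pi.add_apply]
    rw [integral_add ((hint θ hθ).const_mul σ)
      ((hC.const_mul 2).mul_const (Real.exp (m * θ - psi ρ θ))), integral_const_mul, hval,
      integral_mul_const, integral_const_mul]
  rcases le_total θ₀ θ with hle | hle
  · refine (key 1 fun y => ?_).trans ?_
    · rcases le_total 0 (y - m) with hy | hy
      · rw [abs_of_nonneg hy, one_mul]
        have := mul_nonneg hy (Real.exp_pos (θ₀ * (y - m))).le
        linarith
      · rw [abs_of_nonpos hy]
        have := mul_le_mul_of_nonneg_left
          (Real.exp_le_exp.2 (mul_le_mul_of_nonpos_right hle hy)) (neg_nonneg.2 hy)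
        linarith
    · rw [one_mul]
      gcongr
      exact le_abs_self _
  · refine (key (-1) fun y => ?_).trans ?_
    · rcases le_total 0 (y - m) with hy | hy
      · rw [abs_of_nonneg hy]
        have := mul_le_mul_of_nonneg_left
          (Real.exp_le_exp.2 (mul_le_mul_of_nonneg_right hle hy)) hy
        linarith
      · rw [abs_of_nonpos hy]
        have := mul_nonneg (neg_nonneg.2 hy) (Real.exp_pos (θ₀ * (y - m))).le
        linarith
    · rw [neg_one_mul]
      gcongr
      exact neg_le_abs _

/-- Joint integrability of the centred reward. The moment bound leaves the term
`exp (m θ - ψ(θ))`, which for `m = Σ / n` is the `n`-th root of the prior kernel and hence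
bounded. -/
lemma integrable_sub_mul_joint [SFinite ρ] (hΘ : IsOpen (paramSpace ρ))
    (hne : (paramSpace ρ).Nonempty) {S n : ℝ} (h : Admissible ρ S n) :
    Integrable (fun z : ℝ × ℝ => (z.2 - S / n) *
      (rewardDensity ρ z.1 z.2 * priorDensity ρ S n z.1))
      ((volume.restrict (paramSpace ρ)).prod ρ) := by
  have := h.neZero
  have hmeas : Measurable fun z : ℝ × ℝ => (z.2 - S / n) *
      (rewardDensity ρ z.1 z.2 * priorDensity ρ S n z.1) :=
    (measurable_snd.sub_const _).mul (measurable_joint S n)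
  obtain ⟨θ₀, hθ₀, hmax⟩ := exists_mode hΘ hne h
  set m := S / n with hm
  set C := ∫ y, |y - m| * Real.exp (θ₀ * (y - m)) ∂ρ with hC
  have hC0 : 0 ≤ C := integral_nonneg fun y => by positivity
  refine (integrable_prod_iff hmeas.aestronglyMeasurable).2 ⟨?_, ?_⟩
  · filter_upwards [ae_restrict_mem measurableSet_paramSpace] with θ hθ
    have h1 := ((integrable_mul_rewardDensity hΘ hθ).sub
      ((integrable_rewardDensity hθ).const_mul m)).mul_const (priorDensity ρ S n θ)
    refine h1.congr (ae_of_all _ fun y => ?_)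
    simp only [Pi.sub_apply]
    ring
  · have hdom : Integrable (fun θ => |(deriv (psi ρ) θ - m) * priorDensity ρ S n θ|
        + 2 * C * Real.exp (m * θ₀ - psi ρ θ₀) * priorDensity ρ S n θ)
        (volume.restrict (paramSpace ρ)) :=
      (integral_deriv_psi_mul_priorDensity hΘ hne h).1.abs.add
        ((integrableOn_priorDensity h).const_mul _)
    refine hdom.mono' hmeas.aestronglyMeasurable.norm.integral_prod_right' ?_
    filter_upwards [ae_restrict_mem measurableSet_paramSpace] with θ hθ
    have hg := priorDensity_pos hΘ hne h θ
    have e : ∀ y, ‖(y - m) * (rewardDensity ρ θ y * priorDensity ρ S n θ)‖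
        = |y - m| * rewardDensity ρ θ y * priorDensity ρ S n θ := fun y => by
      have : 0 < rewardDensity ρ θ y := Real.exp_pos _
      rw [norm_mul, Real.norm_of_nonneg (mul_pos this hg).le, Real.norm_eq_abs, mul_assoc]
    rw [Real.norm_of_nonneg (integral_nonneg fun y => norm_nonneg _)]
    simp only [e]
    rw [integral_mul_const, abs_mul, abs_of_pos hg, ← add_mul]
    refine mul_le_mul_of_nonneg_right
      ((integral_abs_sub_mul_rewardDensity_le hΘ m hθ hθ₀).trans ?_) hg.le
    refine add_le_add le_rfl (mul_le_mul_of_nonneg_left (Real.exp_le_exp.2 ?_) (by positivity))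
    have h2 := Real.exp_le_exp.1 (hmax θ hθ)
    have hSn : S = m * n := by rw [hm, div_mul_cancel₀ _ h.1.ne']
    rw [hSn] at h2
    refine le_of_mul_le_mul_left ?_ h.1
    linarith

/-- The predictive density as a real number, with the junk value `0` where the posterior after
reward `y` is improper. -/
noncomputable def predictiveReal (ρ : Measure ℝ) (S n y : ℝ) : ℝ :=
  ∫ θ in paramSpace ρ, rewardDensity ρ θ y * priorDensity ρ S n θ

/-- The rewards `y` at which the predictive density is finite. -/
def regularRewards (ρ : Measure ℝ) (S n : ℝ) : Set ℝ :=
  {y | IntegrableOn (fun θ => rewardDensity ρ θ y * priorDensity ρ S n θ) (paramSpace ρ)}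

lemma ae_mem_regularRewards [SFinite ρ] (hΘ : IsOpen (paramSpace ρ))
    (hne : (paramSpace ρ).Nonempty) {S n : ℝ} (h : Admissible ρ S n) :
    ∀ᵐ y ∂ρ, y ∈ regularRewards ρ S n := (integrable_joint hΘ hne h).prod_left_ae

lemma predictiveReal_nonneg [SFinite ρ] (hΘ : IsOpen (paramSpace ρ))
    (hne : (paramSpace ρ).Nonempty) {S n : ℝ} (h : Admissible ρ S n) (y : ℝ) :
    0 ≤ predictiveReal ρ S n y :=
  integral_nonneg fun θ => mul_nonneg (Real.exp_pos _).le (priorDensity_pos hΘ hne h θ).le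

lemma measurable_predictiveReal [SFinite ρ] (S n : ℝ) : Measurable (predictiveReal ρ S n) :=
  (measurable_joint S n).stronglyMeasurable.integral_prod_left'.measurable

lemma predictive_eq [SFinite ρ] (hΘ : IsOpen (paramSpace ρ))
    (hne : (paramSpace ρ).Nonempty) {S n : ℝ} (h : Admissible ρ S n) :
    predictive ρ S n = ρ.withDensity fun y => ENNReal.ofReal (predictiveReal ρ S n y) := by
  refine withDensity_congr_ae ?_
  filter_upwards [ae_mem_regularRewards hΘ hne h] with y hy
  exact (ofReal_integral_eq_lintegral_ofReal hy (ae_of_all _ fun θ =>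
    mul_nonneg (Real.exp_pos _).le (priorDensity_pos hΘ hne h θ).le)).symm

lemma integral_predictive [SFinite ρ] (hΘ : IsOpen (paramSpace ρ))
    (hne : (paramSpace ρ).Nonempty) {S n : ℝ} (h : Admissible ρ S n) (f : ℝ → ℝ) :
    ∫ y, f y ∂(predictive ρ S n) = ∫ y, f y * predictiveReal ρ S n y ∂ρ := by
  rw [predictive_eq hΘ hne h, integral_withDensity_eq_integral_toReal_smul
    (measurable_predictiveReal S n).ennreal_ofReal (ae_of_all _ fun _ => ENNReal.ofReal_lt_top)]
  simp only [ENNReal.toReal_ofReal (predictiveReal_nonneg hΘ hne h _), smul_eq_mul, mul_comm]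

lemma integrable_predictive_iff [SFinite ρ] (hΘ : IsOpen (paramSpace ρ))
    (hne : (paramSpace ρ).Nonempty) {S n : ℝ} (h : Admissible ρ S n) (f : ℝ → ℝ) :
    Integrable f (predictive ρ S n) ↔ Integrable (fun y => f y * predictiveReal ρ S n y) ρ := by
  rw [predictive_eq hΘ hne h, integrable_withDensity_iff_integrable_smul'
    (measurable_predictiveReal S n).ennreal_ofReal (ae_of_all _ fun _ => ENNReal.ofReal_lt_top)]
  simp only [ENNReal.toReal_ofReal (predictiveReal_nonneg hΘ hne h _), smul_eq_mul, mul_comm]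

lemma integrable_predictiveReal [SFinite ρ] (hΘ : IsOpen (paramSpace ρ))
    (hne : (paramSpace ρ).Nonempty) {S n : ℝ} (h : Admissible ρ S n) :
    Integrable (predictiveReal ρ S n) ρ := (integrable_joint hΘ hne h).integral_prod_right

lemma integral_predictiveReal [SFinite ρ] (hΘ : IsOpen (paramSpace ρ))
    (hne : (paramSpace ρ).Nonempty) {S n : ℝ} (h : Admissible ρ S n) :
    ∫ y, predictiveReal ρ S n y ∂ρ = 1 := by
  have := h.neZero
  rw [← integral_priorDensity hΘ hne h]
  simp only [predictiveReal]
  rw [← integral_integral_swap (f := fun θ y => rewardDensity ρ θ y * priorDensity ρ S n θ)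
    (integrable_joint hΘ hne h)]
  refine integral_congr_ae ?_
  filter_upwards [ae_restrict_mem measurableSet_paramSpace] with θ hθ
  rw [integral_mul_const, integral_rewardDensity hθ, one_mul]

lemma isProbabilityMeasure_predictive [SFinite ρ] (hΘ : IsOpen (paramSpace ρ))
    (hne : (paramSpace ρ).Nonempty) {S n : ℝ} (h : Admissible ρ S n) :
    IsProbabilityMeasure (predictive ρ S n) := by
  refine ⟨?_⟩
  rw [predictive_eq hΘ hne h, withDensity_apply _ MeasurableSet.univ, Measure.restrict_univ,
    ← ofReal_integral_eq_lintegral_ofReal (integrable_predictiveReal hΘ hne h)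
      (ae_of_all _ (predictiveReal_nonneg hΘ hne h)), integral_predictiveReal hΘ hne h,
    ENNReal.ofReal_one]

lemma integrable_sub_predictive [SFinite ρ] (hΘ : IsOpen (paramSpace ρ))
    (hne : (paramSpace ρ).Nonempty) {S n : ℝ} (h : Admissible ρ S n) :
    Integrable (fun y => y - S / n) (predictive ρ S n) := by
  rw [integrable_predictive_iff hΘ hne h]
  refine (integrable_sub_mul_joint hΘ hne h).integral_prod_right.congr (ae_of_all _ fun y => ?_)
  simp only [predictiveReal]
  rw [integral_const_mul]

lemma integrable_id_predictive [SFinite ρ] (hΘ : IsOpen (paramSpace ρ))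
    (hne : (paramSpace ρ).Nonempty) {S n : ℝ} (h : Admissible ρ S n) :
    Integrable (fun y => y) (predictive ρ S n) := by
  have := isProbabilityMeasure_predictive hΘ hne h
  exact ((integrable_sub_predictive hΘ hne h).add (integrable_const (S / n))).congr
    (ae_of_all _ fun y => by simp)

lemma integral_sub_predictive [SFinite ρ] (hΘ : IsOpen (paramSpace ρ))
    (hne : (paramSpace ρ).Nonempty) {S n : ℝ} (h : Admissible ρ S n) :
    ∫ y, (y - S / n) ∂(predictive ρ S n) = 0 := by
  have := h.neZero
  rw [integral_predictive hΘ hne h, ← (integral_deriv_psi_mul_priorDensity hΘ hne h).2]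
  simp only [predictiveReal, ← integral_const_mul]
  rw [← integral_integral_swap
    (f := fun θ y => (y - S / n) * (rewardDensity ρ θ y * priorDensity ρ S n θ))
    (integrable_sub_mul_joint hΘ hne h)]
  refine integral_congr_ae ?_
  filter_upwards [ae_restrict_mem measurableSet_paramSpace] with θ hθ
  simp only [← mul_assoc]
  rw [integral_mul_const]
  simp only [sub_mul]
  rw [integral_sub (integrable_mul_rewardDensity hΘ hθ)
    ((integrable_rewardDensity hθ).const_mul _), integral_const_mul, integral_rewardDensity hθ,
    integral_mul_rewardDensity hΘ hθ]
  ring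

lemma integral_id_predictive [SFinite ρ] (hΘ : IsOpen (paramSpace ρ))
    (hne : (paramSpace ρ).Nonempty) {S n : ℝ} (h : Admissible ρ S n) :
    ∫ y, y ∂(predictive ρ S n) = S / n := by
  have := isProbabilityMeasure_predictive hΘ hne h
  have h0 := integral_sub_predictive hΘ hne h
  rw [integral_sub (integrable_id_predictive hΘ hne h) (integrable_const _)] at h0
  simp at h0
  linarith

/-! ### Sign patterns and integral inequalities -/

lemma ae_eq_zero_of_integral_eq_zero {q : ℝ → ℝ} (hq : Integrable q ρ) (h0 : ∫ y, q y ∂ρ = 0)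
    (hs : (∀ᵐ y ∂ρ, 0 ≤ q y) ∨ ∀ᵐ y ∂ρ, q y ≤ 0) : q =ᵐ[ρ] 0 := by
  rcases hs with hs | hs
  · exact (integral_eq_zero_iff_of_nonneg_ae hs hq).1 h0
  · have h1 : (0 : ℝ → ℝ) ≤ᵐ[ρ] fun y => -q y := hs.mono fun y hy => neg_nonneg.2 hy
    have h2 := (integral_eq_zero_iff_of_nonneg_ae h1 hq.neg).1 (by
      rw [integral_neg, h0, neg_zero])
    exact h2.mono fun y hy => neg_eq_zero.1 hy

/-- If `q` has total mass zero and changes sign at most once, from `-` to `+`, then its integral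
against a monotone function is nonnegative. -/
lemma integral_mul_nonneg_of_single_crossing {q f : ℝ → ℝ} {G : Set ℝ}
    (hG : ∀ᵐ y ∂ρ, y ∈ G) (hq : Integrable q ρ) (hfq : Integrable (fun y => f y * q y) ρ)
    (h0 : ∫ y, q y ∂ρ = 0) (hf : Monotone f)
    (hcross : ∀ y₁ ∈ G, ∀ y₂ ∈ G, y₁ < y₂ → 0 ≤ q y₁ → 0 ≤ q y₂) :
    0 ≤ ∫ y, f y * q y ∂ρ := by
  have hzero : ((∀ᵐ y ∂ρ, 0 ≤ q y) ∨ ∀ᵐ y ∂ρ, q y ≤ 0) → 0 ≤ ∫ y, f y * q y ∂ρ := fun hs => by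
    refine integral_nonneg_of_ae ?_
    filter_upwards [ae_eq_zero_of_integral_eq_zero hq h0 hs] with y hy
    simp [hy]
  set J : Set ℝ := {y ∈ G | 0 ≤ q y} with hJ
  rcases J.eq_empty_or_nonempty with he | hne
  · refine hzero (Or.inr (hG.mono fun y hy => (not_le.1 fun h => ?_).le))
    exact he.subset (show y ∈ J from ⟨hy, h⟩)
  by_cases hb : BddBelow J
  · have key : 0 ≤ ∫ y, (f y - f (sInf J)) * q y ∂ρ := by
      refine integral_nonneg_of_ae (hG.mono fun y hy => ?_)
      rcases lt_trichotomy y (sInf J) with hlt | rfl | hlt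
      · have : q y < 0 := not_le.1 fun h => absurd (csInf_le hb ⟨hy, h⟩) (not_le.2 hlt)
        exact mul_nonneg_of_nonpos_of_nonpos (sub_nonpos.2 (hf hlt.le)) this.le
      · simp
      · obtain ⟨z, hz, hzy⟩ := exists_lt_of_csInf_lt hne hlt
        exact mul_nonneg (sub_nonneg.2 (hf hlt.le)) (hcross z hz.1 y hy hzy hz.2)
    simp only [sub_mul] at key
    rwa [integral_sub hfq (hq.const_mul _), integral_const_mul, h0, mul_zero, sub_zero] at key
  · refine hzero (Or.inl (hG.mono fun y hy => ?_))
    obtain ⟨z, hz, hzy⟩ := not_bddBelow_iff.1 hb y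
    exact hcross z hz.1 y hy hzy hz.2

/-- A line that lies above the function `y ↦ (y - a)⁺` on `[s, t]` and below it elsewhere: the
chord, which is one of the two affine pieces of the function if `a` is not in `(s, t)`. -/
lemma exists_line_hinge (a : ℝ) {s t : ℝ} (hst : s ≤ t) :
    ∃ α β : ℝ, ∀ y, (s ≤ y → y ≤ t → max (y - a) 0 ≤ α + β * y) ∧
      (y ≤ s ∨ t ≤ y → α + β * y ≤ max (y - a) 0) := by
  rcases le_total a s with h | h
  · refine ⟨-a, 1, fun y => ⟨fun h1 _ => max_le (by linarith) (by linarith), fun _ => ?_⟩⟩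
    exact le_max_of_le_left (by linarith)
  rcases le_total t a with h' | h'
  · refine ⟨0, 0, fun y => ⟨fun _ h1 => max_le (by linarith) (by linarith), fun _ => ?_⟩⟩
    exact le_max_of_le_right (by linarith)
  rcases hst.eq_or_lt with rfl | hlt
  · refine ⟨0, 0, fun y => ⟨fun _ h1 => max_le (by linarith) (by linarith), fun _ => ?_⟩⟩
    exact le_max_of_le_right (by linarith)
  set β := (t - a) / (t - s) with hβ
  have hd : 0 < t - s := by linarith
  have hβ0 : 0 ≤ β := div_nonneg (by linarith) hd.le
  have hβ1 : 0 ≤ 1 - β := by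
    rw [hβ, one_sub_div hd.ne']
    exact div_nonneg (by linarith) hd.le
  have e : β * (t - s) = t - a := div_mul_cancel₀ _ hd.ne'
  refine ⟨-β * s, β, fun y => ⟨fun h1 h2 => max_le ?_ ?_, ?_⟩⟩
  · have := mul_nonneg hβ1 (sub_nonneg.2 h2)
    linarith
  · have := mul_nonneg hβ0 (sub_nonneg.2 h1)
    linarith
  · rintro (h1 | h1)
    · have := mul_nonneg hβ0 (sub_nonneg.2 h1)
      exact le_max_of_le_right (by linarith)
    · have := mul_nonneg hβ1 (sub_nonneg.2 h1)
      exact le_max_of_le_left (by linarith)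

/-- If `q` has mass and first moment zero and the signs of `q` follow the pattern `-, +, -`, then
its integral against the convex function `y ↦ (y - a)⁺` is nonpositive: subtract a line such that
the difference has the signs `+, -, +` with changes at the same places. -/
lemma integral_hinge_mul_nonpos {q : ℝ → ℝ} {G : Set ℝ} (a : ℝ)
    (hG : ∀ᵐ y ∂ρ, y ∈ G) (hq : Integrable q ρ) (hyq : Integrable (fun y => y * q y) ρ)
    (hfq : Integrable (fun y => max (y - a) 0 * q y) ρ)
    (h0 : ∫ y, q y ∂ρ = 0) (h1 : ∫ y, y * q y ∂ρ = 0)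
    (hcross : ∀ y₁ ∈ G, ∀ y₂ ∈ G, ∀ y₃ ∈ G, y₁ < y₂ → y₂ < y₃ →
      0 ≤ q y₁ → 0 ≤ q y₃ → 0 ≤ q y₂) :
    ∫ y, max (y - a) 0 * q y ∂ρ ≤ 0 := by
  have hzero : ((∀ᵐ y ∂ρ, 0 ≤ q y) ∨ ∀ᵐ y ∂ρ, q y ≤ 0) →
      ∫ y, max (y - a) 0 * q y ∂ρ ≤ 0 := fun hs => by
    refine integral_nonpos_of_ae ?_
    filter_upwards [ae_eq_zero_of_integral_eq_zero hq h0 hs] with y hy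
    simp [hy]
  have key : ∀ α β : ℝ, (∀ y ∈ G, (max (y - a) 0 - (α + β * y)) * q y ≤ 0) →
      ∫ y, max (y - a) 0 * q y ∂ρ ≤ 0 := fun α β hαβ => by
    have h2 : ∫ y, (max (y - a) 0 - (α + β * y)) * q y ∂ρ ≤ 0 :=
      integral_nonpos_of_ae (hG.mono hαβ)
    have e : ∀ y, (max (y - a) 0 - (α + β * y)) * q y
        = max (y - a) 0 * q y - (α * q y + β * (y * q y)) := fun y => by ring
    simp only [e] at h2
    have hi : Integrable (fun y => α * q y + β * (y * q y)) ρ :=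
      (hq.const_mul _).add (hyq.const_mul _)
    rw [integral_sub hfq hi, integral_add (hq.const_mul _) (hyq.const_mul _), integral_const_mul,
      integral_const_mul, h0, h1] at h2
    linarith
  set J : Set ℝ := {y ∈ G | 0 ≤ q y} with hJ
  have hneg : ∀ y ∈ G, y ∉ J → q y ≤ 0 := fun y hy hyJ =>
    (not_le.1 fun h => hyJ ⟨hy, h⟩).le
  rcases J.eq_empty_or_nonempty with he | hne
  · exact hzero (Or.inr (hG.mono fun y hy => hneg y hy (by simp [he])))
  by_cases hb : BddBelow J <;> by_cases ha : BddAbove J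
  · obtain ⟨α, β, hl⟩ := exists_line_hinge a (Real.sInf_le_sSup J hb ha)
    refine key α β fun y hy => ?_
    rcases le_or_gt y (sInf J) with c1 | c1
    · by_cases hyJ : y ∈ J
      · exact mul_nonpos_of_nonpos_of_nonneg (sub_nonpos.2 ((hl y).1 (csInf_le hb hyJ)
          (le_csSup ha hyJ))) hyJ.2
      · exact mul_nonpos_of_nonneg_of_nonpos (sub_nonneg.2 ((hl y).2 (Or.inl c1))) (hneg y hy hyJ)
    rcases le_or_gt (sSup J) y with c2 | c2
    · by_cases hyJ : y ∈ J
      · exact mul_nonpos_of_nonpos_of_nonneg (sub_nonpos.2 ((hl y).1 (csInf_le hb hyJ)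
          (le_csSup ha hyJ))) hyJ.2
      · exact mul_nonpos_of_nonneg_of_nonpos (sub_nonneg.2 ((hl y).2 (Or.inr c2))) (hneg y hy hyJ)
    obtain ⟨z, hz, hzy⟩ := exists_lt_of_csInf_lt hne c1
    obtain ⟨w, hw, hyw⟩ := exists_lt_of_lt_csSup hne c2
    exact mul_nonpos_of_nonpos_of_nonneg (sub_nonpos.2 ((hl y).1 c1.le c2.le))
      (hcross z hz.1 y hy w hw.1 hzy hyw hz.2 hw.2)
  · -- signs `-, +`: a line of slope one, as the hinge is 1-Lipschitz
    refine key (max (sInf J - a) 0 - sInf J) 1 fun y hy => ?_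
    rcases lt_trichotomy y (sInf J) with c | rfl | c
    · refine mul_nonpos_of_nonneg_of_nonpos ?_
        (hneg y hy fun h => absurd (csInf_le hb h) (not_le.2 c))
      have : max (sInf J - a) 0 ≤ max (y - a) 0 + (sInf J - y) :=
        max_le (by linarith [le_max_left (y - a) 0]) (by linarith [le_max_right (y - a) 0])
      linarith
    · simp
    · obtain ⟨z, hz, hzy⟩ := exists_lt_of_csInf_lt hne c
      obtain ⟨w, hw, hyw⟩ := not_bddAbove_iff.1 ha y
      refine mul_nonpos_of_nonpos_of_nonneg ?_ (hcross z hz.1 y hy w hw.1 hzy hyw hz.2 hw.2)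
      have : max (y - a) 0 ≤ max (sInf J - a) 0 + (y - sInf J) :=
        max_le (by linarith [le_max_left (sInf J - a) 0])
          (by linarith [le_max_right (sInf J - a) 0])
      linarith
  · -- signs `+, -`: a constant, as the hinge is monotone
    refine key (max (sSup J - a) 0) 0 fun y hy => ?_
    rw [zero_mul, add_zero]
    rcases lt_trichotomy y (sSup J) with c | rfl | c
    · obtain ⟨z, hz, hzy⟩ := not_bddBelow_iff.1 hb y
      obtain ⟨w, hw, hyw⟩ := exists_lt_of_lt_csSup hne c
      refine mul_nonpos_of_nonpos_of_nonneg ?_ (hcross z hz.1 y hy w hw.1 hzy hyw hz.2 hw.2)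
      exact sub_nonpos.2 (max_le_max (by linarith) le_rfl)
    · simp
    · refine mul_nonpos_of_nonneg_of_nonpos ?_
        (hneg y hy fun h => absurd (le_csSup ha h) (not_le.2 c))
      exact sub_nonneg.2 (max_le_max (by linarith) le_rfl)
  · refine hzero (Or.inl (hG.mono fun y hy => ?_))
    obtain ⟨z, hz, hzy⟩ := not_bddBelow_iff.1 hb y
    obtain ⟨w, hw, hyw⟩ := not_bddAbove_iff.1 ha y
    exact hcross z hz.1 y hy w hw.1 hzy hyw hz.2 hw.2

/-! ### Total positivity of the exponential family -/

/-- The exponential sum `A exp (-p θ) - 1 + B exp (r θ)` with coefficient signs `+, -, +` can be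
made to vanish at two given points. It is convex, hence nonpositive between them and nonnegative
elsewhere. -/
lemma exists_exp_sum {p r θ₁ θ₂ : ℝ} (hp : 0 < p) (hr : 0 < r) (hθ : θ₁ < θ₂) :
    ∃ A B : ℝ, 0 ≤ A ∧ 0 ≤ B ∧ ∀ θ,
      (θ₁ ≤ θ → θ ≤ θ₂ → A * Real.exp (-p * θ) + B * Real.exp (r * θ) ≤ 1) ∧
      (θ < θ₁ ∨ θ₂ < θ → 1 ≤ A * Real.exp (-p * θ) + B * Real.exp (r * θ)) := by
  have hr' : Real.exp (r * θ₁) < Real.exp (r * θ₂) :=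
    Real.exp_lt_exp.2 (mul_lt_mul_of_pos_left hθ hr)
  have hp' : Real.exp (-p * θ₂) < Real.exp (-p * θ₁) :=
    Real.exp_lt_exp.2 (mul_lt_mul_of_neg_left hθ (by linarith))
  set D := Real.exp (-p * θ₁) * Real.exp (r * θ₂) - Real.exp (-p * θ₂) * Real.exp (r * θ₁)
    with hD
  have hD0 : 0 < D := sub_pos.2
    (mul_lt_mul hp' hr'.le (Real.exp_pos _) (Real.exp_pos _).le)
  set A := (Real.exp (r * θ₂) - Real.exp (r * θ₁)) / D with hA
  set B := (Real.exp (-p * θ₁) - Real.exp (-p * θ₂)) / D with hB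
  have hA0 : 0 ≤ A := div_nonneg (by linarith) hD0.le
  have hB0 : 0 ≤ B := div_nonneg (by linarith) hD0.le
  set w : ℝ → ℝ := fun θ => A * Real.exp (-p * θ) + B * Real.exp (r * θ) with hw
  have e1 : w θ₁ = 1 := by
    simp only [hw, hA, hB]
    rw [div_mul_eq_mul_div, div_mul_eq_mul_div, ← add_div, div_eq_one_iff_eq hD0.ne', hD]
    ring
  have e2 : w θ₂ = 1 := by
    simp only [hw, hA, hB]
    rw [div_mul_eq_mul_div, div_mul_eq_mul_div, ← add_div, div_eq_one_iff_eq hD0.ne', hD]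
    ring
  have hconv : ConvexOn ℝ Set.univ w := by
    have hexp : ∀ c : ℝ, ConvexOn ℝ Set.univ fun θ : ℝ => Real.exp (c * θ) := fun c => by
      simpa using! convexOn_exp.comp_linearMap (LinearMap.mulLeft ℝ c)
    exact ((hexp (-p)).smul hA0).add ((hexp r).smul hB0)
  refine ⟨A, B, hA0, hB0, fun θ => ⟨fun h1 h2 => ?_, fun h => ?_⟩⟩
  · have := hconv.le_max_of_mem_Icc (Set.mem_univ θ₁) (Set.mem_univ θ₂) ⟨h1, h2⟩
    rwa [e1, e2, max_self] at this
  · change 1 ≤ w θ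
    by_contra! hlt
    rcases h with h | h
    · have := hconv.lt_right_of_left_lt (Set.mem_univ θ) (Set.mem_univ θ₂)
        (z := θ₁) (by rw [openSegment_eq_Ioo (h.trans hθ)]; exact ⟨h, hθ⟩) (by rwa [e1])
      linarith
    · have := hconv.lt_left_of_right_lt (Set.mem_univ θ₁) (Set.mem_univ θ)
        (z := θ₂) (by rw [openSegment_eq_Ioo (hθ.trans h)]; exact ⟨hθ, h⟩) (by rwa [e2])
      linarith

/-- A signed prior density with signs `-, +` induces a signed predictive density with the same
pattern. -/
lemma predictive_single_crossing [SFinite ρ] {r : ℝ → ℝ} {θ₀ y₁ y₂ : ℝ} (hy : y₁ < y₂)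
    (i₁ : IntegrableOn (fun θ => rewardDensity ρ θ y₁ * r θ) (paramSpace ρ))
    (i₂ : IntegrableOn (fun θ => rewardDensity ρ θ y₂ * r θ) (paramSpace ρ))
    (hpos : ∀ θ, θ₀ ≤ θ → 0 ≤ r θ) (hneg : ∀ θ, θ ≤ θ₀ → r θ ≤ 0)
    (h : 0 ≤ ∫ θ in paramSpace ρ, rewardDensity ρ θ y₁ * r θ) :
    0 ≤ ∫ θ in paramSpace ρ, rewardDensity ρ θ y₂ * r θ := by
  have key : 0 ≤ ∫ θ in paramSpace ρ, (rewardDensity ρ θ y₂ * r θ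
      - Real.exp (θ₀ * (y₂ - y₁)) * (rewardDensity ρ θ y₁ * r θ)) := by
    refine integral_nonneg fun θ => ?_
    have e : Real.exp (θ₀ * (y₂ - y₁)) * rewardDensity ρ θ y₁
        = Real.exp (θ₀ * (y₂ - y₁) + θ * y₁ - psi ρ θ) := by
      rw [rewardDensity, ← Real.exp_add]
      congr 1
      ring
    change 0 ≤ rewardDensity ρ θ y₂ * r θ
      - Real.exp (θ₀ * (y₂ - y₁)) * (rewardDensity ρ θ y₁ * r θ)
    rw [← mul_assoc, e, ← sub_mul, rewardDensity]
    rcases le_total θ₀ θ with hle | hle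
    · refine mul_nonneg (sub_nonneg.2 (Real.exp_le_exp.2 ?_)) (hpos θ hle)
      have := mul_le_mul_of_nonneg_right hle (sub_pos.2 hy).le
      linarith
    · refine mul_nonneg_of_nonpos_of_nonpos (sub_nonpos.2 (Real.exp_le_exp.2 ?_)) (hneg θ hle)
      have := mul_le_mul_of_nonneg_right hle (sub_pos.2 hy).le
      linarith
  rw [integral_sub i₂ (i₁.const_mul _), integral_const_mul] at key
  have := mul_nonneg (Real.exp_pos (θ₀ * (y₂ - y₁))).le h
  linarith

/-- A signed prior density with signs `-, +, -` induces a signed predictive density with the same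
pattern: combine the predictive densities at three rewards with the coefficients of an
exponential sum that changes sign where the prior density does. -/
lemma predictive_double_crossing [SFinite ρ] {r : ℝ → ℝ} {θ₁ θ₂ y₁ y₂ y₃ : ℝ} (hθ : θ₁ < θ₂)
    (hy : y₁ < y₂) (hy' : y₂ < y₃)
    (i₁ : IntegrableOn (fun θ => rewardDensity ρ θ y₁ * r θ) (paramSpace ρ))
    (i₂ : IntegrableOn (fun θ => rewardDensity ρ θ y₂ * r θ) (paramSpace ρ))
    (i₃ : IntegrableOn (fun θ => rewardDensity ρ θ y₃ * r θ) (paramSpace ρ))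
    (hpos : ∀ θ ∈ paramSpace ρ, θ₁ ≤ θ → θ ≤ θ₂ → 0 ≤ r θ)
    (hneg : ∀ θ ∈ paramSpace ρ, θ < θ₁ ∨ θ₂ < θ → r θ ≤ 0)
    (h₁ : 0 ≤ ∫ θ in paramSpace ρ, rewardDensity ρ θ y₁ * r θ)
    (h₃ : 0 ≤ ∫ θ in paramSpace ρ, rewardDensity ρ θ y₃ * r θ) :
    0 ≤ ∫ θ in paramSpace ρ, rewardDensity ρ θ y₂ * r θ := by
  obtain ⟨A, B, hA, hB, hw⟩ := exists_exp_sum (sub_pos.2 hy) (sub_pos.2 hy') hθ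
  have key : 0 ≤ ∫ θ in paramSpace ρ, (rewardDensity ρ θ y₂ * r θ
      - (A * (rewardDensity ρ θ y₁ * r θ) + B * (rewardDensity ρ θ y₃ * r θ))) := by
    refine integral_nonneg_of_ae ?_
    filter_upwards [ae_restrict_mem measurableSet_paramSpace] with θ hθΘ
    have e₁ : rewardDensity ρ θ y₁ = rewardDensity ρ θ y₂ * Real.exp (-(y₂ - y₁) * θ) := by
      rw [rewardDensity, rewardDensity, ← Real.exp_add]
      congr 1
      ring
    have e₃ : rewardDensity ρ θ y₃ = rewardDensity ρ θ y₂ * Real.exp ((y₃ - y₂) * θ) := by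
      rw [rewardDensity, rewardDensity, ← Real.exp_add]
      congr 1
      ring
    have e : rewardDensity ρ θ y₂ * r θ
        - (A * (rewardDensity ρ θ y₁ * r θ) + B * (rewardDensity ρ θ y₃ * r θ))
        = rewardDensity ρ θ y₂ * ((1 - (A * Real.exp (-(y₂ - y₁) * θ)
          + B * Real.exp ((y₃ - y₂) * θ))) * r θ) := by
      rw [e₁, e₃]
      ring
    rw [Pi.zero_apply, e]
    refine mul_nonneg (Real.exp_pos _).le ?_
    by_cases hin : θ₁ ≤ θ ∧ θ ≤ θ₂
    · exact mul_nonneg (sub_nonneg.2 ((hw θ).1 hin.1 hin.2)) (hpos θ hθΘ hin.1 hin.2)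
    · have hout : θ < θ₁ ∨ θ₂ < θ := by
        by_contra! hc
        exact hin hc
      exact mul_nonneg_of_nonpos_of_nonpos (sub_nonpos.2 ((hw θ).2 hout)) (hneg θ hθΘ hout)
  have hi : IntegrableOn (fun θ => A * (rewardDensity ρ θ y₁ * r θ)
      + B * (rewardDensity ρ θ y₃ * r θ)) (paramSpace ρ) :=
    Integrable.add (i₁.const_mul _) (i₃.const_mul _)
  rw [integral_sub i₂ hi, integral_add (i₁.const_mul _) (i₃.const_mul _), integral_const_mul,
    integral_const_mul] at key
  have := mul_nonneg hA h₁
  have := mul_nonneg hB h₃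
  linarith

/-! ### Stochastic comparison of predictive laws -/

lemma integrable_hinge [SFinite ρ] (hΘ : IsOpen (paramSpace ρ)) (hne : (paramSpace ρ).Nonempty)
    {S n : ℝ} (h : Admissible ρ S n) (a : ℝ) :
    Integrable (fun y => max (y - a) 0) (predictive ρ S n) := by
  have := isProbabilityMeasure_predictive hΘ hne h
  exact ((integrable_id_predictive hΘ hne h).sub (integrable_const a)).pos_part

lemma predictiveReal_sub {S n S' n' y : ℝ} (hy : y ∈ regularRewards ρ S n)
    (hy' : y ∈ regularRewards ρ S' n') :
    IntegrableOn (fun θ => rewardDensity ρ θ y * (priorDensity ρ S' n' θ - priorDensity ρ S n θ))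
      (paramSpace ρ) ∧
    predictiveReal ρ S' n' y - predictiveReal ρ S n y = ∫ θ in paramSpace ρ,
      rewardDensity ρ θ y * (priorDensity ρ S' n' θ - priorDensity ρ S n θ) := by
  simp only [mul_sub]
  exact ⟨Integrable.sub hy' hy, (integral_sub hy' hy).symm⟩

lemma ae_mem_regularRewards_inter [SFinite ρ] (hΘ : IsOpen (paramSpace ρ))
    (hne : (paramSpace ρ).Nonempty) {S n S' n' : ℝ} (h : Admissible ρ S n)
    (h' : Admissible ρ S' n') :
    ∀ᵐ y ∂ρ, y ∈ regularRewards ρ S n ∩ regularRewards ρ S' n' :=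
  (ae_mem_regularRewards hΘ hne h).and (ae_mem_regularRewards hΘ hne h')

lemma integral_mul_predictiveReal_sub [SFinite ρ] (hΘ : IsOpen (paramSpace ρ))
    (hne : (paramSpace ρ).Nonempty) {S n S' n' : ℝ} (h : Admissible ρ S n)
    (h' : Admissible ρ S' n') {f : ℝ → ℝ} (hf : Integrable f (predictive ρ S n))
    (hf' : Integrable f (predictive ρ S' n')) :
    Integrable (fun y => f y * (predictiveReal ρ S' n' y - predictiveReal ρ S n y)) ρ ∧
    ∫ y, f y * (predictiveReal ρ S' n' y - predictiveReal ρ S n y) ∂ρ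
      = ∫ y, f y ∂(predictive ρ S' n') - ∫ y, f y ∂(predictive ρ S n) := by
  rw [integral_predictive hΘ hne h, integral_predictive hΘ hne h']
  have i := (integrable_predictive_iff hΘ hne h f).1 hf
  have i' := (integrable_predictive_iff hΘ hne h' f).1 hf'
  simp only [mul_sub]
  exact ⟨i'.sub i, integral_sub i' i⟩

/-- The predictive law is stochastically increasing in `Σ`: the ratio of the prior densities is an
increasing exponential. -/
lemma integral_hinge_mono [SFinite ρ] (hΘ : IsOpen (paramSpace ρ))
    (hne : (paramSpace ρ).Nonempty) {S S' n : ℝ} (h : Admissible ρ S n)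
    (h' : Admissible ρ S' n) (hS : S ≤ S') (a : ℝ) :
    ∫ y, max (y - a) 0 ∂(predictive ρ S n) ≤ ∫ y, max (y - a) 0 ∂(predictive ρ S' n) := by
  rcases hS.eq_or_lt with rfl | hlt
  · exact le_rfl
  obtain ⟨i, e⟩ := integral_mul_predictiveReal_sub hΘ hne h h' (integrable_hinge hΘ hne h a)
    (integrable_hinge hΘ hne h' a)
  rw [← sub_nonneg, ← e]
  refine integral_mul_nonneg_of_single_crossing (ae_mem_regularRewards_inter hΘ hne h h')
    ((integrable_predictiveReal hΘ hne h').sub (integrable_predictiveReal hΘ hne h)) i ?_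
    (fun y y' hy => max_le_max (by linarith) le_rfl) ?_
  · rw [integral_sub (integrable_predictiveReal hΘ hne h') (integrable_predictiveReal hΘ hne h),
      integral_predictiveReal hΘ hne h, integral_predictiveReal hΘ hne h', sub_self]
  intro y₁ hy₁ y₂ hy₂ hy h0
  obtain ⟨i₁, e₁⟩ := predictiveReal_sub hy₁.1 hy₁.2
  obtain ⟨i₂, e₂⟩ := predictiveReal_sub hy₂.1 hy₂.2
  rw [e₁] at h0
  rw [e₂]
  have hZ := integral_priorKernel_pos hΘ hne h
  have hZ' := integral_priorKernel_pos hΘ hne h'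
  set Z := ∫ θ in paramSpace ρ, priorKernel ρ S n θ with hZdef
  set Z' := ∫ θ in paramSpace ρ, priorKernel ρ S' n θ with hZdef'
  have hd : 0 < S' - S := sub_pos.2 hlt
  -- the prior densities agree where `exp ((S' - S) θ) = Z' / Z`
  have hr : ∀ θ, priorDensity ρ S' n θ - priorDensity ρ S n θ
      = priorKernel ρ S n θ / Z' * (Real.exp ((S' - S) * θ) - Z' / Z) := fun θ => by
    have : priorKernel ρ S' n θ = priorKernel ρ S n θ * Real.exp ((S' - S) * θ) := by
      rw [priorKernel, priorKernel, ← Real.exp_add]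
      congr 1
      ring
    simp only [priorDensity, ← hZdef, ← hZdef', this]
    field_simp
  have hpos : ∀ θ, 0 ≤ priorKernel ρ S n θ / Z' := fun θ => (div_pos (priorKernel_pos S n θ) hZ').le
  refine predictive_single_crossing (θ₀ := Real.log (Z' / Z) / (S' - S)) hy i₁ i₂
    (fun θ hθ => ?_) (fun θ hθ => ?_) h0
  · rw [div_le_iff₀ hd, Real.log_le_iff_le_exp (div_pos hZ' hZ), mul_comm] at hθ
    rw [hr]
    exact mul_nonneg (hpos θ) (sub_nonneg.2 hθ)
  · rw [le_div_iff₀ hd, Real.le_log_iff_exp_le (div_pos hZ' hZ), mul_comm] at hθ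
    rw [hr]
    exact mul_nonpos_of_nonneg_of_nonpos (hpos θ) (sub_nonpos.2 hθ)

/-- Scaling up a state concentrates the prior: the ratio of the densities is a power of the kernel,
so that the density increases on a superlevel set of the kernel and decreases off it. -/
lemma exists_level_priorDensity_smul [SFinite ρ] (hΘ : IsOpen (paramSpace ρ))
    (hne : (paramSpace ρ).Nonempty) {S n c : ℝ} (h : Admissible ρ S n) (hc : 1 < c) :
    ∃ κ > 0, ∀ θ,
      (κ ≤ priorKernel ρ S n θ → 0 ≤ priorDensity ρ (c * S) (c * n) θ - priorDensity ρ S n θ) ∧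
      (priorKernel ρ S n θ < κ →
        priorDensity ρ (c * S) (c * n) θ - priorDensity ρ S n θ ≤ 0) := by
  have hZ := integral_priorKernel_pos hΘ hne h
  have hZ' := integral_priorKernel_pos hΘ hne (h.smul hΘ hne hc.le)
  set Z := ∫ θ in paramSpace ρ, priorKernel ρ S n θ with hZdef
  set Z' := ∫ θ in paramSpace ρ, priorKernel ρ (c * S) (c * n) θ with hZdef'
  have hd : 0 < c - 1 := by linarith
  have hq : 0 < Z' / Z := div_pos hZ' hZ
  have hr : ∀ θ, priorDensity ρ (c * S) (c * n) θ - priorDensity ρ S n θ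
      = priorKernel ρ S n θ / Z' * (priorKernel ρ S n θ ^ (c - 1) - Z' / Z) := fun θ => by
    have : priorKernel ρ (c * S) (c * n) θ
        = priorKernel ρ S n θ * priorKernel ρ S n θ ^ (c - 1) := by
      simp only [priorKernel, ← Real.exp_mul, ← Real.exp_add]
      congr 1
      ring
    simp only [priorDensity, ← hZdef, ← hZdef', this]
    field_simp
  have hpos : ∀ θ, 0 ≤ priorKernel ρ S n θ / Z' := fun θ => (div_pos (priorKernel_pos S n θ) hZ').le
  have hκ : ((Z' / Z) ^ (c - 1)⁻¹) ^ (c - 1) = Z' / Z := Real.rpow_inv_rpow hq.le hd.ne'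
  refine ⟨(Z' / Z) ^ (c - 1)⁻¹, Real.rpow_pos_of_pos hq _, fun θ => ⟨fun hθ => ?_, fun hθ => ?_⟩⟩
  · rw [hr]
    refine mul_nonneg (hpos θ) (sub_nonneg.2 ?_)
    rw [← hκ]
    exact Real.rpow_le_rpow (Real.rpow_pos_of_pos hq _).le hθ hd.le
  · rw [hr]
    refine mul_nonpos_of_nonneg_of_nonpos (hpos θ) (sub_nonpos.2 ?_)
    rw [← hκ]
    exact Real.rpow_le_rpow (priorKernel_pos S n θ).le hθ.le hd.le

/-- Scaling up a state makes the predictive law smaller in the convex order. -/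
lemma integral_hinge_smul_le [SFinite ρ] (hΘ : IsOpen (paramSpace ρ))
    (hne : (paramSpace ρ).Nonempty) {S n c : ℝ} (h : Admissible ρ S n) (hc : 1 ≤ c) (a : ℝ) :
    ∫ y, max (y - a) 0 ∂(predictive ρ (c * S) (c * n))
      ≤ ∫ y, max (y - a) 0 ∂(predictive ρ S n) := by
  rcases hc.eq_or_lt with rfl | hlt
  · simp
  have h' := h.smul hΘ hne hc
  have hnz := h.neZero
  obtain ⟨i, e⟩ := integral_mul_predictiveReal_sub hΘ hne h h' (integrable_hinge hΘ hne h a)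
    (integrable_hinge hΘ hne h' a)
  obtain ⟨iy, ey⟩ := integral_mul_predictiveReal_sub hΘ hne h h'
    (integrable_id_predictive hΘ hne h) (integrable_id_predictive hΘ hne h')
  rw [← sub_nonpos, ← e]
  refine integral_hinge_mul_nonpos a (ae_mem_regularRewards_inter hΘ hne h h')
    ((integrable_predictiveReal hΘ hne h').sub (integrable_predictiveReal hΘ hne h)) iy i ?_ ?_ ?_
  · rw [integral_sub (integrable_predictiveReal hΘ hne h') (integrable_predictiveReal hΘ hne h),
      integral_predictiveReal hΘ hne h, integral_predictiveReal hΘ hne h', sub_self]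
  · rw [ey, integral_id_predictive hΘ hne h, integral_id_predictive hΘ hne h',
      mul_div_mul_left _ _ (by linarith), sub_self]
  intro y₁ hy₁ y₂ hy₂ y₃ hy₃ h12 h23 h1 h3
  obtain ⟨i₁, e₁⟩ := predictiveReal_sub hy₁.1 hy₁.2
  obtain ⟨i₂, e₂⟩ := predictiveReal_sub hy₂.1 hy₂.2
  obtain ⟨i₃, e₃⟩ := predictiveReal_sub hy₃.1 hy₃.2
  rw [e₁] at h1
  rw [e₃] at h3
  rw [e₂]
  obtain ⟨κ, hκ, hsign⟩ := exists_level_priorDensity_smul hΘ hne h hlt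
  -- if the density increases at one point at most, then the two priors coincide
  have hdeg : (superlevel ρ S n κ).Subsingleton → 0 ≤ ∫ θ in paramSpace ρ, rewardDensity ρ θ y₂ *
      (priorDensity ρ (c * S) (c * n) θ - priorDensity ρ S n θ) := fun hsub => by
    have hint := (integrableOn_priorDensity h').sub (integrableOn_priorDensity h)
    have hae := ae_eq_zero_of_integral_eq_zero hint (by
      simp only [Pi.sub_apply]
      rw [integral_sub (integrableOn_priorDensity h') (integrableOn_priorDensity h),
        integral_priorDensity hΘ hne h, integral_priorDensity hΘ hne h', sub_self]) (Or.inr (by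
      filter_upwards [ae_restrict_mem measurableSet_paramSpace,
        ae_restrict_of_ae (measure_eq_zero_iff_ae_notMem.1 (hsub.measure_zero volume))]
        with θ hθ hθκ
      exact (hsign θ).2 (not_le.1 fun hle => hθκ ⟨hθ, hle⟩)))
    refine integral_nonneg_of_ae ?_
    filter_upwards [hae] with θ hθ
    rw [Pi.zero_apply, Pi.sub_apply] at hθ
    simp [hθ]
  rcases (superlevel ρ S n κ).eq_empty_or_nonempty with he | ⟨θ₀, hθ₀⟩
  · exact hdeg (by rw [he]; exact Set.subsingleton_empty)
  obtain ⟨θ₁, θ₂, hI, ha, hb, -, -⟩ := superlevel_eq_Icc hΘ h hκ hθ₀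
  rcases (ha.trans hb).eq_or_lt with heq | hθ
  · exact hdeg (by rw [hI, heq, Set.Icc_self]; exact Set.subsingleton_singleton)
  refine predictive_double_crossing hθ h12 h23 i₁ i₂ i₃ (fun θ hθΘ hl hr => ?_)
    (fun θ hθΘ hout => ?_) h1 h3
  · have : θ ∈ superlevel ρ S n κ := by rw [hI]; exact ⟨hl, hr⟩
    exact (hsign θ).1 this.2
  · refine (hsign θ).2 (not_le.1 fun hle => ?_)
    have : θ ∈ Set.Icc θ₁ θ₂ := by rw [← hI]; exact ⟨hθΘ, hle⟩
    rcases hout with ho | ho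
    · exact absurd this.1 (not_le.2 ho)
    · exact absurd this.2 (not_le.2 ho)

/-! ### The expected gain from one observation -/

/-- The expected excess over the charge `lam` of the posterior mean after one more reward. -/
noncomputable def gain (ρ : Measure ℝ) (S n lam : ℝ) : ℝ :=
  ∫ y, max ((S + y) / (n + 1) - lam) 0 ∂(predictive ρ S n)

lemma integrable_gain [SFinite ρ] (hΘ : IsOpen (paramSpace ρ)) (hne : (paramSpace ρ).Nonempty)
    {S n : ℝ} (h : Admissible ρ S n) (lam : ℝ) :
    Integrable (fun y => max ((S + y) / (n + 1) - lam) 0) (predictive ρ S n) := by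
  have := isProbabilityMeasure_predictive hΘ hne h
  exact ((((integrable_const S).add (integrable_id_predictive hΘ hne h)).div_const (n + 1)).sub
    (integrable_const lam)).pos_part

lemma gain_nonneg (S n lam : ℝ) : 0 ≤ gain ρ S n lam :=
  integral_nonneg fun _ => le_max_right _ _

lemma gain_antitone [SFinite ρ] (hΘ : IsOpen (paramSpace ρ)) (hne : (paramSpace ρ).Nonempty)
    {S n : ℝ} (h : Admissible ρ S n) : Antitone (gain ρ S n) := fun _ _ hl =>
  integral_mono (integrable_gain hΘ hne h _) (integrable_gain hΘ hne h _) fun _ =>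
    max_le_max (by linarith) le_rfl

lemma lipschitzWith_gain [SFinite ρ] (hΘ : IsOpen (paramSpace ρ)) (hne : (paramSpace ρ).Nonempty)
    {S n : ℝ} (h : Admissible ρ S n) : LipschitzWith 1 (gain ρ S n) := by
  have := isProbabilityMeasure_predictive hΘ hne h
  refine LipschitzWith.of_le_add fun x z => ?_
  have h1 : gain ρ S n x ≤ ∫ y, (max ((S + y) / (n + 1) - z) 0 + dist x z) ∂(predictive ρ S n) :=
    integral_mono (integrable_gain hΘ hne h x)
      ((integrable_gain hΘ hne h z).add (integrable_const _)) fun y => by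
        have h2 := neg_abs_le (x - z)
        have h3 := le_max_left ((S + y) / (n + 1) - z) 0
        have h4 := le_max_right ((S + y) / (n + 1) - z) 0
        rw [← Real.dist_eq] at h2
        exact max_le (by linarith) (add_nonneg h4 dist_nonneg)
  rw [integral_add (integrable_gain hΘ hne h z) (integrable_const _)] at h1
  simpa [gain] using h1

lemma gain_eq_hinge {S n : ℝ} (hn : 0 < n) (lam : ℝ) :
    gain ρ S n lam = (∫ y, max (y - (lam * (n + 1) - S)) 0 ∂(predictive ρ S n)) / (n + 1) := by
  have hn1 : 0 < n + 1 := by linarith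
  rw [gain, ← integral_div]
  refine integral_congr_ae (ae_of_all _ fun y => ?_)
  simp only
  rw [← max_div_div_right hn1.le, zero_div]
  congr 1
  field_simp
  ring

lemma gain_mono [SFinite ρ] (hΘ : IsOpen (paramSpace ρ)) (hne : (paramSpace ρ).Nonempty)
    {S S' n : ℝ} (h : Admissible ρ S n) (h' : Admissible ρ S' n) (hS : S ≤ S') (lam : ℝ) :
    gain ρ S n lam ≤ gain ρ S' n lam := by
  rw [gain_eq_hinge h.1, gain_eq_hinge h.1]
  refine div_le_div_of_nonneg_right ?_ (by linarith [h.1])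
  refine (integral_hinge_mono hΘ hne h h' hS _).trans ?_
  exact integral_mono (integrable_hinge hΘ hne h' _) (integrable_hinge hΘ hne h' _) fun y =>
    max_le_max (by linarith) le_rfl

/-- Scaling up a state reduces the expected gain, for two reasons: the predictive law gets smaller
in the convex order, and the posterior mean reacts less to the reward. -/
lemma gain_smul_le [SFinite ρ] (hΘ : IsOpen (paramSpace ρ)) (hne : (paramSpace ρ).Nonempty)
    {S n c : ℝ} (h : Admissible ρ S n) (hc : 1 ≤ c) (lam : ℝ) :
    gain ρ (c * S) (c * n) lam ≤ gain ρ S n lam := by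
  have := isProbabilityMeasure_predictive hΘ hne h
  have h' := h.smul hΘ hne hc
  have hn := h.1
  have hb : 0 < n + 1 := by linarith
  have hb' : 0 < c * n + 1 := by linarith [h'.1]
  have hnc : n ≤ c * n := le_mul_of_one_le_left hn.le hc
  set G := gain ρ S n lam with hG
  -- Jensen's inequality
  have hJ : max (S / n - lam) 0 ≤ G := by
    refine max_le ?_ (gain_nonneg S n lam)
    have hi : Integrable (fun y => (S + y) / (n + 1)) (predictive ρ S n) :=
      ((integrable_const S).add (integrable_id_predictive hΘ hne h)).div_const (n + 1)
    have h1 : ∫ y, ((S + y) / (n + 1) - lam) ∂(predictive ρ S n) ≤ G :=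
      integral_mono (hi.sub (integrable_const lam))
        (integrable_gain hΘ hne h lam) fun y => le_max_left _ _
    rw [integral_sub hi (integrable_const lam), integral_div,
      integral_add (integrable_const S) (integrable_id_predictive hΘ hne h),
      integral_id_predictive hΘ hne h] at h1
    simp only [integral_const, probReal_univ, one_smul] at h1
    have e : (S + S / n) / (n + 1) = S / n := by field_simp
    linarith
  -- the posterior mean moves from `S / n` by the fraction `σ` of the original movement
  set σ := (n + 1) / (c * n + 1) with hσ
  have hσ0 : 0 ≤ σ := (div_pos hb hb').le
  have hσ1 : σ ≤ 1 := (div_le_one hb').2 (by linarith)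
  have hstep : (∫ y, max (y - (lam * (c * n + 1) - c * S)) 0 ∂(predictive ρ S n)) / (c * n + 1)
      ≤ σ * G + (1 - σ) * max (S / n - lam) 0 := by
    have hi : Integrable (fun y => σ * max ((S + y) / (n + 1) - lam) 0
        + (1 - σ) * max (S / n - lam) 0) (predictive ρ S n) :=
      ((integrable_gain hΘ hne h lam).const_mul σ).add (integrable_const _)
    have h1 : ∫ y, max (y - (lam * (c * n + 1) - c * S)) 0 / (c * n + 1) ∂(predictive ρ S n)
        ≤ ∫ y, (σ * max ((S + y) / (n + 1) - lam) 0
          + (1 - σ) * max (S / n - lam) 0) ∂(predictive ρ S n) := by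
      refine integral_mono ((integrable_hinge hΘ hne h _).div_const _) hi fun y => ?_
      have e : (y - (lam * (c * n + 1) - c * S)) / (c * n + 1)
          = σ * ((S + y) / (n + 1) - lam) + (1 - σ) * (S / n - lam) := by
        rw [hσ]
        field_simp
        ring
      simp only
      rw [← max_div_div_right hb'.le, zero_div, e]
      refine max_le (add_le_add ?_ ?_) (add_nonneg ?_ ?_)
      · exact mul_le_mul_of_nonneg_left (le_max_left _ _) hσ0
      · exact mul_le_mul_of_nonneg_left (le_max_left _ _) (by linarith)
      · exact mul_nonneg hσ0 (le_max_right _ _)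
      · exact mul_nonneg (by linarith) (le_max_right _ _)
    rw [integral_div, integral_add ((integrable_gain hΘ hne h lam).const_mul σ)
      (integrable_const _), integral_const_mul] at h1
    simpa [gain, hG] using h1
  rw [gain_eq_hinge h'.1]
  refine (div_le_div_of_nonneg_right (integral_hinge_smul_le hΘ hne h hc _) hb'.le).trans
    (hstep.trans ?_)
  have := mul_le_mul_of_nonneg_left hJ (sub_nonneg.2 hσ1)
  linarith

/-! ### The index as a root -/

/-- The value of continuing at charge `lam` when learning is weighted by `H`; `valueKG` is its
positive part. -/
noncomputable def continueValue (ρ : Measure ℝ) (S n H lam : ℝ) : ℝ :=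
  S / n - lam + H * gain ρ S n lam

lemma valueKG_eq (t : ℕ) (S n γ lam : ℝ) :
    valueKG ρ t S n γ lam = max (continueValue ρ S n (multiplier γ t) lam) 0 := by
  have e : ∀ x : ℝ, max (max x lam - lam) 0 = max (x - lam) 0 := fun x => by
    rcases le_total x lam with hx | hx
    · rw [max_eq_right hx, sub_self, max_self, max_eq_right (sub_nonpos.2 hx)]
    · rw [max_eq_left hx]
  simp only [valueKG, continueValue, gain, e]

lemma strictAnti_continueValue [SFinite ρ] (hΘ : IsOpen (paramSpace ρ))
    (hne : (paramSpace ρ).Nonempty) {S n H : ℝ} (h : Admissible ρ S n) (hH : 0 ≤ H) :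
    StrictAnti (continueValue ρ S n H) := fun x y hxy => by
  have := mul_le_mul_of_nonneg_left (gain_antitone hΘ hne h hxy.le) hH
  simp only [continueValue]
  linarith

lemma exists_continueValue_eq_zero [SFinite ρ] (hΘ : IsOpen (paramSpace ρ))
    (hne : (paramSpace ρ).Nonempty) {S n H : ℝ} (h : Admissible ρ S n) (hH : 0 ≤ H) :
    ∃ lam, continueValue ρ S n H lam = 0 := by
  have hcont : Continuous (continueValue ρ S n H) := by
    have := (lipschitzWith_gain hΘ hne h).continuous
    unfold continueValue
    fun_prop
  have hG := mul_nonneg hH (gain_nonneg (ρ := ρ) S n (S / n))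
  have hle : S / n ≤ S / n + H * gain ρ S n (S / n) := by linarith
  obtain ⟨lam, -, hlam⟩ := intermediate_value_Icc' hle hcont.continuousOn
    (show (0 : ℝ) ∈ _ from ⟨by
      have := mul_le_mul_of_nonneg_left (gain_antitone hΘ hne h hle) hH
      simp only [continueValue]
      linarith, by simpa [continueValue] using hG⟩)
  exact ⟨lam, hlam⟩

lemma isLeast_of_continueValue_eq_zero [SFinite ρ] (hΘ : IsOpen (paramSpace ρ))
    (hne : (paramSpace ρ).Nonempty) {S n γ lam : ℝ} {t : ℕ} (h : Admissible ρ S n)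
    (hH : 0 ≤ multiplier γ t) (hlam : continueValue ρ S n (multiplier γ t) lam = 0) :
    IsLeast {lam : ℝ | valueKG ρ t S n γ lam = 0} lam := by
  refine ⟨by simp [valueKG_eq, hlam], fun x hx => ?_⟩
  have hx' : continueValue ρ S n (multiplier γ t) x ≤ 0 := by
    have hx0 : valueKG ρ t S n γ x = 0 := hx
    rw [valueKG_eq] at hx0
    exact max_eq_right_iff.1 hx0
  rw [← hlam] at hx'
  exact (strictAnti_continueValue hΘ hne h hH).le_iff_ge.1 hx'

lemma index_natCast (t : ℕ) (S n γ : ℝ) : index ρ t S n γ = indexFin ρ t S n γ := by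
  simp [index]

lemma multiplier_nonneg {γ : ℝ} (hγ0 : 0 ≤ γ) (hγ1 : γ ≤ 1) {t : ℕ} (ht : 1 ≤ t) :
    0 ≤ multiplier γ t := by
  unfold multiplier
  split_ifs
  · exact sub_nonneg.2 (by exact_mod_cast ht)
  · exact div_nonneg (mul_nonneg hγ0 (sub_nonneg.2 (pow_le_one₀ hγ0 hγ1))) (sub_nonneg.2 hγ1)

lemma tendsto_multiplier {γ : ℝ} (hγ0 : 0 ≤ γ) (hγ1 : γ < 1) :
    Tendsto (multiplier γ) atTop (𝓝 (γ / (1 - γ))) := by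
  have h1 := (tendsto_pow_atTop_nhds_zero_of_lt_one hγ0 hγ1).comp (tendsto_sub_atTop_nat 1)
  have h2 := ((tendsto_const_nhds (x := (1 : ℝ)).sub h1).const_mul γ).div_const (1 - γ)
  rw [sub_zero, mul_one] at h2
  refine h2.congr fun t => ?_
  simp [multiplier, hγ1.ne]

lemma isLeast_index [SFinite ρ] (hΘ : IsOpen (paramSpace ρ)) (hne : (paramSpace ρ).Nonempty)
    {S n γ : ℝ} (hγ0 : 0 ≤ γ) (hγ1 : γ ≤ 1) (h : Admissible ρ S n) {t : ℕ} (ht : 1 ≤ t) :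
    IsLeast {lam : ℝ | valueKG ρ t S n γ lam = 0} (index ρ t S n γ) ∧
    continueValue ρ S n (multiplier γ t) (index ρ t S n γ) = 0 := by
  have hH := multiplier_nonneg hγ0 hγ1 ht
  obtain ⟨lam, hlam⟩ := exists_continueValue_eq_zero hΘ hne h hH
  have hleast := isLeast_of_continueValue_eq_zero hΘ hne h hH hlam
  have e : index ρ t S n γ = lam := by rw [index_natCast]; exact hleast.csInf_eq
  rw [e]
  exact ⟨hleast, hlam⟩

/-- The finite indices converge to the root for the limit `γ / (1 - γ)` of the multipliers. -/
lemma tendsto_index [SFinite ρ] (hΘ : IsOpen (paramSpace ρ)) (hne : (paramSpace ρ).Nonempty)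
    {S n γ : ℝ} (hγ0 : 0 ≤ γ) (hγ1 : γ < 1) (h : Admissible ρ S n) :
    Tendsto (fun t : ℕ => index ρ t S n γ) atTop (𝓝 (index ρ ⊤ S n γ)) ∧
    continueValue ρ S n (γ / (1 - γ)) (index ρ ⊤ S n γ) = 0 := by
  have hH : 0 ≤ γ / (1 - γ) := div_nonneg hγ0 (by linarith)
  obtain ⟨lam, hlam⟩ := exists_continueValue_eq_zero hΘ hne h hH
  have hanti := strictAnti_continueValue hΘ hne h hH
  have hptw : ∀ x, Tendsto (fun t => continueValue ρ S n (multiplier γ t) x) atTop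
      (𝓝 (continueValue ρ S n (γ / (1 - γ)) x)) := fun x =>
    ((tendsto_multiplier hγ0 hγ1).mul_const _).const_add _
  have hlim : Tendsto (fun t : ℕ => index ρ t S n γ) atTop (𝓝 lam) := by
    refine tendsto_order.2 ⟨fun x hx => ?_, fun x hx => ?_⟩
    · have hpos : 0 < continueValue ρ S n (γ / (1 - γ)) x := hlam ▸ hanti hx
      filter_upwards [(hptw x).eventually_const_lt hpos, eventually_ge_atTop 1] with t ht ht1
      rw [← (isLeast_index hΘ hne hγ0 hγ1.le h ht1).2] at ht
      exact (strictAnti_continueValue hΘ hne h (multiplier_nonneg hγ0 hγ1.le ht1)).lt_iff_gt.1 ht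
    · have hneg : continueValue ρ S n (γ / (1 - γ)) x < 0 := hlam ▸ hanti hx
      filter_upwards [(hptw x).eventually_lt_const hneg, eventually_ge_atTop 1] with t ht ht1
      rw [← (isLeast_index hΘ hne hγ0 hγ1.le h ht1).2] at ht
      exact (strictAnti_continueValue hΘ hne h (multiplier_nonneg hγ0 hγ1.le ht1)).lt_iff_gt.1 ht
  have e : index ρ ⊤ S n γ = lam := by
    simp only [index_natCast] at hlim
    simpa [index] using hlim.limUnder_eq
  rw [e]
  exact ⟨hlim, hlam⟩

/-- For every time-to-go there is one weight of learning for which the indices of all states are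
the roots of their continuation values. -/
lemma exists_continueValue_index_eq_zero [SFinite ρ] (hΘ : IsOpen (paramSpace ρ))
    (hne : (paramSpace ρ).Nonempty) {γ : ℝ} (hγ0 : 0 ≤ γ) (hγ1 : γ ≤ 1) {s : ℕ∞} (hs : s ≠ 0)
    (hsγ : s = ⊤ → γ < 1) :
    ∃ H, 0 ≤ H ∧ ∀ S n, Admissible ρ S n → continueValue ρ S n H (index ρ s S n γ) = 0 := by
  induction s with
  | top =>
    exact ⟨γ / (1 - γ), div_nonneg hγ0 (by linarith), fun S n h =>
      (tendsto_index hΘ hne hγ0 (hsγ rfl) h).2⟩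
  | coe t =>
    have ht : 1 ≤ t := Nat.one_le_iff_ne_zero.2 (by exact_mod_cast hs)
    exact ⟨multiplier γ t, multiplier_nonneg hγ0 hγ1 ht, fun S n h =>
      (isLeast_index hΘ hne hγ0 hγ1 h ht).2⟩

lemma continueValue_smul_le [SFinite ρ] (hΘ : IsOpen (paramSpace ρ))
    (hne : (paramSpace ρ).Nonempty) {S n c H : ℝ} (h : Admissible ρ S n) (hc : 1 ≤ c)
    (hH : 0 ≤ H) (lam : ℝ) :
    continueValue ρ (c * S) (c * n) H lam ≤ continueValue ρ S n H lam := by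
  have := mul_le_mul_of_nonneg_left (gain_smul_le hΘ hne h hc lam) hH
  simp only [continueValue, mul_div_mul_left _ _ (show c ≠ 0 by linarith)]
  linarith

lemma index_mono [SFinite ρ] (hΘ : IsOpen (paramSpace ρ)) (hne : (paramSpace ρ).Nonempty)
    {γ : ℝ} (hγ0 : 0 ≤ γ) (hγ1 : γ ≤ 1) {s : ℕ∞} (hs : s ≠ 0) (hsγ : s = ⊤ → γ < 1)
    {S S' n : ℝ} (h : Admissible ρ S n) (h' : Admissible ρ S' n) (hS : S ≤ S') :
    index ρ s S n γ ≤ index ρ s S' n γ := by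
  obtain ⟨H, hH, hroot⟩ := exists_continueValue_index_eq_zero hΘ hne hγ0 hγ1 hs hsγ
  rw [← (strictAnti_continueValue hΘ hne h' hH).le_iff_ge, hroot S' n h', ← hroot S n h]
  exact add_le_add (sub_le_sub_right (div_le_div_of_nonneg_right hS h.1.le) _)
    (mul_le_mul_of_nonneg_left (gain_mono hΘ hne h h' hS _) hH)

lemma index_smul_le [SFinite ρ] (hΘ : IsOpen (paramSpace ρ)) (hne : (paramSpace ρ).Nonempty)
    {γ : ℝ} (hγ0 : 0 ≤ γ) (hγ1 : γ ≤ 1) {s : ℕ∞} (hs : s ≠ 0) (hsγ : s = ⊤ → γ < 1)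
    {S n c : ℝ} (h : Admissible ρ S n) (hc : 1 ≤ c) :
    index ρ s (c * S) (c * n) γ ≤ index ρ s S n γ := by
  obtain ⟨H, hH, hroot⟩ := exists_continueValue_index_eq_zero hΘ hne hγ0 hγ1 hs hsγ
  have h' := h.smul hΘ hne hc
  rw [← (strictAnti_continueValue hΘ hne h hH).le_iff_ge, hroot S n h,
    ← hroot (c * S) (c * n) h']
  exact continueValue_smul_le hΘ hne h hc hH _

/-- A dominating arm has a strictly larger index: scale its state up to the precision `n'` of the
dominated arm, and then lower `Σ`, which costs at least the difference of the means. -/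
lemma Dominates.index_lt [SFinite ρ] (hΘ : IsOpen (paramSpace ρ)) (hne : (paramSpace ρ).Nonempty)
    {γ : ℝ} (hγ0 : 0 ≤ γ) (hγ1 : γ ≤ 1) {s : ℕ∞} (hs : s ≠ 0) (hsγ : s = ⊤ → γ < 1)
    {S n S' n' : ℝ} (h : Admissible ρ S n) (h' : Admissible ρ S' n')
    (hdom : Dominates S n S' n') : index ρ s S' n' γ < index ρ s S n γ := by
  obtain ⟨H, hH, hroot⟩ := exists_continueValue_index_eq_zero hΘ hne hγ0 hγ1 hs hsγ
  have hc : 1 ≤ n' / n := (one_le_div h.1).2 hdom.2.le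
  have hcn : n' / n * n = n' := div_mul_cancel₀ _ h.1.ne'
  have hmid := h.smul hΘ hne hc
  have hle := continueValue_smul_le hΘ hne h hc hH (index ρ s S' n' γ)
  rw [hcn] at hmid hle
  have hmean : n' / n * S / n' = S / n := by
    have := h.1.ne'
    have := h'.1.ne'
    field_simp
  have hS : S' ≤ n' / n * S := by
    have := hdom.1
    rw [← hmean, div_lt_div_iff_of_pos_right h'.1] at this
    exact this.le
  have hg := mul_le_mul_of_nonneg_left (gain_mono hΘ hne h' hmid hS (index ρ s S' n' γ)) hH
  have h0 := hroot S' n' h'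
  rw [← (strictAnti_continueValue hΘ hne h hH).lt_iff_gt, hroot S n h]
  refine lt_of_lt_of_le ?_ hle
  simp only [continueValue] at h0 ⊢
  rw [hmean]
  have := hdom.1
  linarith

end KGBandit

theorem theorem4p2 (ρ : Measure ℝ) [SigmaFinite ρ]
    (hΘ : IsOpen (KGBandit.paramSpace ρ)) (hΘne : (KGBandit.paramSpace ρ).Nonempty)
    (γ : ℝ) (hγ0 : 0 ≤ γ) (hγ1 : γ ≤ 1) :
    -- the predictive laws, the indices and their infinite-horizon limits are well defined
    (∀ S n : ℝ, KGBandit.Admissible ρ S n →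
      IsProbabilityMeasure (KGBandit.predictive ρ S n) ∧
      Integrable (fun y : ℝ => y) (KGBandit.predictive ρ S n) ∧
      ∫ y, y ∂(KGBandit.predictive ρ S n) = S / n ∧
      (∀ t : ℕ, 1 ≤ t →
        IsLeast {lam : ℝ | KGBandit.valueKG ρ t S n γ lam = 0} (KGBandit.index ρ t S n γ)) ∧
      (γ < 1 →
        Tendsto (fun t : ℕ => KGBandit.index ρ t S n γ) atTop (𝓝 (KGBandit.index ρ ⊤ S n γ)))) ∧
    -- the index is increasing in the first state variable
    (∀ s : ℕ∞, s ≠ 0 → (s = ⊤ → γ < 1) → ∀ S S' n : ℝ,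
      KGBandit.Admissible ρ S n → KGBandit.Admissible ρ S' n → S ≤ S' →
      KGBandit.index ρ s S n γ ≤ KGBandit.index ρ s S' n γ) ∧
    -- the index in the scaled state is decreasing in the scale
    (∀ s : ℕ∞, s ≠ 0 → (s = ⊤ → γ < 1) → ∀ S n c c' : ℝ, 0 < c → c ≤ c' →
      KGBandit.Admissible ρ (c * S) (c * n) → KGBandit.Admissible ρ (c' * S) (c' * n) →
      KGBandit.index ρ s (c' * S) (c' * n) γ ≤ KGBandit.index ρ s (c * S) (c * n) γ) ∧
    -- the KGI policy does not choose dominated arms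
    (∀ T : ℕ∞, (T = ⊤ → γ < 1) → ∀ t : ℕ, (t : ℕ∞) < T →
      ∀ (k : ℕ) (S n : Fin k → ℝ), (∀ a, KGBandit.Admissible ρ (S a) (n a)) →
      ∀ a : Fin k, KGBandit.IsKGIAction ρ γ T t S n a →
        ¬ ∃ b : Fin k, KGBandit.Dominates (S b) (n b) (S a) (n a)) := by
  refine ⟨fun S n h => ⟨KGBandit.isProbabilityMeasure_predictive hΘ hΘne h,
      KGBandit.integrable_id_predictive hΘ hΘne h, KGBandit.integral_id_predictive hΘ hΘne h,
      fun t ht => (KGBandit.isLeast_index hΘ hΘne hγ0 hγ1 h ht).1,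
      fun hγ => (KGBandit.tendsto_index hΘ hΘne hγ0 hγ h).1⟩,
    fun s hs hsγ S S' n h h' hS => KGBandit.index_mono hΘ hΘne hγ0 hγ1 hs hsγ h h' hS,
    fun s hs hsγ S n c c' hc hcc h _ => ?_, fun T hT t htT k S n hadm a ha => ?_⟩
  · have e : c' / c * c = c' := div_mul_cancel₀ _ hc.ne'
    have := KGBandit.index_smul_le hΘ hΘne hγ0 hγ1 hs hsγ h ((one_le_div hc).2 hcc)
    rwa [← mul_assoc, ← mul_assoc, e] at this
  · rintro ⟨b, hb⟩
    have hs : T - (t : ℕ∞) ≠ 0 := (tsub_pos_of_lt htT).ne'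
    have hsγ : T - (t : ℕ∞) = ⊤ → γ < 1 := fun h => hT (ENat.sub_eq_top_iff.1 h).1
    exact absurd (ha b)
      (not_le.2 (hb.index_lt hΘ hΘne hγ0 hγ1 hs hsγ (hadm b) (hadm a)))
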